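/- **Setting.** Let $(G,S)$ be a Coxeter system with $S$ finite, with Coxeter matrix $m$, and let $\Gamma$ be its Coxeter graph with the labels forgotten: the vertex set is $S$, and distinct $s,t$ are joined if and only if $m(s,t)\neq 2$, i.e. if and only if $s$ and $t$ do not commute. Let $I(S)$ be the set of all subsets of $S$ that are independent in $\Gamma$ (the sets of mutually commuting generators), and fix a total order $<$ on $S$. For a representation $A$ of $G$, the Coxeter cochain complex is $$X_C^k=\bigoplus_{T\in I(S),\ |T|=k}A^{\langle T\rangle}\quad(k\ge 0),\qquad d^k=\sum_{T,s}d_{T,s},\qquad d_{T,s}\colon A^{\langle T\rangle}\to A^{\langle T\cup\{s\}\rangle},\quad d_{T,s}(v)=(-1)^{|\{t\in T:\,t<s\}|}(v+s(v)),$$ the sum being over all $T\in I(S)$ with $|T|=k$ and all $s\in S\setminus T$ with $T\cup\{s\}\in I(S)$; $H_C^i(G,A)$ denotes its $i$-th cohomology. The real reflection representation $V_n$ of $G$, where $n=|S|$, has a basis $(\alpha_s)_{s\in S}$, and $s\in S$ acts by $v\mapsto v-2(\alpha_s,v)\alpha_s$, where $(\alpha_s,\alpha_t)=-\cos(\pi/m(s,t))$.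 **Theorem.** Suppose that $G$ is finite and irreducible (i.e. $\Gamma$ is connected), of rank $n=|S|$. Then $\Gamma$ is a path with $n$ vertices, or a graph of type $\mathsf D_n$ with $n\ge4$ (a tree with one trivalent vertex and arms of $1,1,n-3$ vertices), or of type $\mathsf E_n$ with $n\in\{6,7,8\}$ (a tree with one trivalent vertex and arms of $1,2,n-4$ vertices). The Coxeter cohomology of $G$ with coefficients in $V_n$ depends only on $\Gamma$, and for all $i\ge 0$ it is as follows. 1. If $\Gamma$ is a path (types $\mathsf A_n$, $\mathsf B_n$, $\mathsf F_4$, $\mathsf H_3$, $\mathsf H_4$, $\mathsf I_2(p)$), then $$H_C^i(G,V_n)\cong\begin{cases}\mathbb R^{i-1}&\text{if }n=3i-1,\\ \mathbb R^{2i}&\text{if }n=3i,\\ \mathbb R^{i+1}&\text{if }n=3i+1,\\ 0&\text{otherwise.}\end{cases}$$ 2. If $\Gamma$ is of type $\mathsf D_n$, $n\ge 4$, then $$H_C^{i}(G,V_n)\cong\begin{cases}\mathbb R^{i+1}&\text{if }n=3i,\\ \mathbb R^{2i+1}&\text{if }n=3i+1,\\ \mathbb R^{i}&\text{if }n=3i+2,\\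 0&\text{otherwise.}\end{cases}$$ (Equivalently, $H_C^{i+1}(\mathsf D_n,V_n)\cong\mathbb R^{i+2},\ \mathbb R^{2i+3},\ \mathbb R^{i+1}$ for $n=3i+3,\ 3i+4,\ 3i+5$ respectively, and all other groups vanish.) 3. If $\Gamma$ is of type $\mathsf E_6$, $\mathsf E_7$, $\mathsf E_8$, then $H_C^2(G,V_n)\cong\mathbb R,\ \mathbb R^2,\ \mathbb R$ respectively, and $H_C^i(G,V_n)=0$ for all $i\neq 2$. -/

import Mathlib

noncomputable section

/-! ## Coxeter graphs -/

/-- The Coxeter graph (labels forgotten): distinct generators are joined iff they do not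
commute, i.e. iff `m(i, j) ≠ 2` (the value `0` encodes `∞`). -/
def CoxeterMatrix.coxeterGraph {B : Type*} (M : CoxeterMatrix B) : SimpleGraph B where
  Adj i j := i ≠ j ∧ M i j ≠ 2
  symm := ⟨fun i j h => ⟨h.1.symm, by rw [M.symmetric]; exact h.2⟩⟩
  loopless := ⟨fun _ h => h.1 rfl⟩

/-- A path `0 — 1 — ⋯ — (n - 2)` together with one further vertex `n - 1`, joined to the
vertex `k` of the path. -/
def branchedPath (k n : ℕ) : SimpleGraph (Fin n) :=
  SimpleGraph.fromRel fun i j : Fin n =>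
    ((i : ℕ) + 1 = j ∧ (j : ℕ) + 1 < n) ∨ ((i : ℕ) = k ∧ (j : ℕ) + 1 = n)

/-- The Coxeter graph of type `D n` (for `4 ≤ n`); the arms at the trivalent vertex have
`1`, `1` and `n - 3` vertices. -/
def graphD (n : ℕ) : SimpleGraph (Fin n) := branchedPath 1 n

/-- The Coxeter graph of type `E n` (for `n = 6, 7, 8`); the arms at the trivalent vertex have
`1`, `2` and `n - 4` vertices. -/
def graphE (n : ℕ) : SimpleGraph (Fin n) := branchedPath 2 n

/-! ## The reflection representation -/

/-- The Gram matrix `(α i, α j) = - cos (π / m(i, j))` of the simple roots.  For `m(i, j) = ∞`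
(encoded as `0`) it is `- cos 0 = -1`, as it should be. -/
def CoxeterMatrix.gram {B : Type*} (M : CoxeterMatrix B) (i j : B) : ℝ :=
  - Real.cos (Real.pi / M i j)

/-- The linear form `v ↦ 2 (α i, v)` on the space with basis the simple roots. -/
def CoxeterMatrix.simpleCoroot {B : Type*} [Fintype B] (M : CoxeterMatrix B) (i : B) :
    Module.Dual ℝ (B → ℝ) :=
  ∑ j, (2 * M.gram i j) • LinearMap.proj j

theorem CoxeterMatrix.simpleCoroot_apply {B : Type*} [Fintype B] (M : CoxeterMatrix B) (i : B)
    (v : B → ℝ) : M.simpleCoroot i v = ∑ j, 2 * M.gram i j * v j := by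
  simp [CoxeterMatrix.simpleCoroot]

theorem CoxeterMatrix.simpleCoroot_single {B : Type*} [Fintype B] [DecidableEq B]
    (M : CoxeterMatrix B) (i j : B) :
    M.simpleCoroot i (Pi.single j 1) = 2 * M.gram i j := by
  simp [CoxeterMatrix.simpleCoroot_apply, Pi.single_apply]

theorem CoxeterMatrix.simpleCoroot_self {B : Type*} [Fintype B] [DecidableEq B]
    (M : CoxeterMatrix B) (i : B) : M.simpleCoroot i (Pi.single i 1) = 2 := by
  simp [CoxeterMatrix.simpleCoroot_single, CoxeterMatrix.gram]

/-- The simple reflection `v ↦ v - 2 (α i, v) α i`, where `α i` is the `i`-th basis vector. -/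
def CoxeterMatrix.simpleReflection {B : Type*} [Fintype B] [DecidableEq B]
    (M : CoxeterMatrix B) (i : B) : (B → ℝ) ≃ₗ[ℝ] (B → ℝ) :=
  Module.reflection (M.simpleCoroot_self i)

theorem CoxeterMatrix.simpleReflection_apply {B : Type*} [Fintype B] [DecidableEq B]
    (M : CoxeterMatrix B) (i : B) (v : B → ℝ) :
    M.simpleReflection i v = v - M.simpleCoroot i v • Pi.single i 1 :=
  Module.reflection_apply _ _

open Polynomial.Chebyshev in
theorem CoxeterMatrix.simpleReflection_mul_pow {B : Type*} [Fintype B] [DecidableEq B]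
    (M : CoxeterMatrix B) (i j : B) :
    (M.simpleReflection i * M.simpleReflection j) ^ M i j = 1 := by
  rcases eq_or_ne i j with rfl | hij
  · rw [M.diagonal, pow_one]
    ext1 v
    exact Module.involutive_reflection (M.simpleCoroot_self i) v
  have hsymm : M.gram j i = M.gram i j := by
    simp [CoxeterMatrix.gram, M.symmetric j i]
  have h1 : M i j ≠ 1 := M.off_diagonal i j hij
  ext1 v
  rw [LinearEquiv.coe_one, id_eq, CoxeterMatrix.simpleReflection,
    CoxeterMatrix.simpleReflection,
    Module.reflection_mul_reflection_pow_apply (M.simpleCoroot_self i) (M.simpleCoroot_self j)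
      (M i j) v (2 * Real.cos (2 * (Real.pi / M i j))) (by
        rw [M.simpleCoroot_single, M.simpleCoroot_single, hsymm, CoxeterMatrix.gram,
          Real.cos_two_mul]
        ring)]
  generalize hm : M i j = m at *
  by_cases h0 : m = 0
  · subst h0; simp
  by_cases h2 : m = 2
  · subst h2
    have hc : M.gram i j = 0 := by simp [CoxeterMatrix.gram, hm]
    have e1 : M.simpleCoroot i (Pi.single j 1) = 0 := by
      rw [M.simpleCoroot_single, hc, mul_zero]
    have e2 : M.simpleCoroot j (Pi.single i 1) = 0 := by
      rw [M.simpleCoroot_single, hsymm, hc, mul_zero]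
    rw [e1, e2]
    have a : (((2 : ℕ) : ℤ) - 2) / 2 = 0 := by norm_num
    have b : (((2 : ℕ) : ℤ) - 1) / 2 = 0 := by norm_num
    have c : (((2 : ℕ) : ℤ) - 3) / 2 = -1 := by norm_num
    have d : ((2 : ℕ) : ℤ) / 2 = 1 := by norm_num
    rw [a, b, c, d]
    have hcos : Real.cos (2 * (Real.pi / ((2 : ℕ) : ℝ))) = -1 := by
      rw [show (2 : ℝ) * (Real.pi / ((2 : ℕ) : ℝ)) = Real.pi by push_cast; ring, Real.cos_pi]
    rw [hcos]
    simp only [S_zero, S_one, S_neg_one, Polynomial.eval_one, Polynomial.eval_X,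
      Polynomial.eval_zero]
    module
  have h3 : 3 ≤ m := by omega
  have hm0 : (0 : ℝ) < m := by positivity
  set θ : ℝ := 2 * (Real.pi / m) with hθ
  have hmθ : (m : ℝ) * θ = 2 * Real.pi := by rw [hθ]; field_simp
  have hsin : Real.sin θ ≠ 0 := by
    apply ne_of_gt
    apply Real.sin_pos_of_pos_of_lt_pi
    · positivity
    · have : (3 : ℝ) ≤ m := by exact_mod_cast h3
      have hpi := Real.pi_pos
      by_contra hcon
      have hcon' : Real.pi ≤ θ := not_lt.mp hcon
      nlinarith
  have hS : ∀ n : ℤ, (S ℝ n).eval (2 * Real.cos θ) = Real.sin ((n + 1) * θ) / Real.sin θ := by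
    intro n
    rw [eq_div_iff hsin, S_two_mul_real_cos]
  rcases Nat.even_or_odd' m with ⟨k, hk | hk⟩
  · have hk' : (k : ℝ) * θ = Real.pi := by
      have : (m : ℝ) = 2 * k := by exact_mod_cast hk
      rw [this] at hmθ; linarith
    have a : ((m : ℤ) - 2) / 2 = k - 1 := by omega
    have b : ((m : ℤ) - 1) / 2 = k - 1 := by omega
    rw [a, b, hS ((k : ℤ) - 1)]
    have : Real.sin ((((k : ℤ) - 1 : ℤ) + 1 : ℝ) * θ) = 0 := by
      push_cast
      rw [sub_add_cancel, hk', Real.sin_pi]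
    rw [this]
    simp
  · have hk' : (2 * (k : ℝ) + 1) * θ = 2 * Real.pi := by
      have : (m : ℝ) = 2 * k + 1 := by exact_mod_cast hk
      rw [this] at hmθ; linarith
    have a : ((m : ℤ) - 2) / 2 = k - 1 := by omega
    have b : ((m : ℤ) - 1) / 2 = k := by omega
    have c : ((m : ℤ) - 3) / 2 = k - 1 := by omega
    have d : (m : ℤ) / 2 = k := by omega
    have key : (S ℝ (k : ℤ)).eval (2 * Real.cos θ) + (S ℝ ((k : ℤ) - 1)).eval (2 * Real.cos θ)
        = 0 := by
      rw [hS, hS, ← add_div]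
      have : Real.sin ((((k : ℤ) : ℝ) + 1) * θ) = - Real.sin ((((k : ℤ) - 1 : ℤ) + 1 : ℝ) * θ) := by
        push_cast
        rw [sub_add_cancel, show ((k : ℝ) + 1) * θ = 2 * Real.pi - k * θ by linarith,
          Real.sin_two_pi_sub]
      rw [this]
      simp
    rw [a, b, c, d, key]
    simp

/-- The (real, geometric) reflection representation of a Coxeter group: the generator `s i` acts
on the real vector space with basis the simple roots by the simple reflection `i`. -/
def CoxeterSystem.reflectionRep {B : Type*} [Fintype B] [DecidableEq B] {M : CoxeterMatrix B}
    {W : Type*} [Group W] (cs : CoxeterSystem M W) : Representation ℝ W (B → ℝ) :=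
  (LinearEquiv.automorphismGroup.toLinearMapMonoidHom (R := ℝ) (M := B → ℝ)).comp
    (cs.lift ⟨M.simpleReflection, M.simpleReflection_mul_pow⟩)

theorem CoxeterSystem.reflectionRep_simple {B : Type*} [Fintype B] [DecidableEq B]
    {M : CoxeterMatrix B} {W : Type*} [Group W] (cs : CoxeterSystem M W) (i : B) (v : B → ℝ) :
    cs.reflectionRep (cs.simple i) v = v - M.simpleCoroot i v • Pi.single i 1 := by
  rw [← M.simpleReflection_apply]
  exact LinearEquiv.congr_fun (cs.lift_apply_simple M.simpleReflection_mul_pow i) v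

/-! ## The Coxeter cochain complex -/

/-- The members of `I(S)` of cardinality `k`: the independent sets of `k` vertices of the Coxeter
graph, i.e. the sets of `k` mutually commuting generators. -/
def CoxeterMatrix.IndepSets {B : Type*} (M : CoxeterMatrix B) (k : ℕ) : Type _ :=
  {T : Finset B // M.coxeterGraph.IsIndepSet (T : Set B) ∧ T.card = k}

/-- The invariants `A^⟨T⟩` of the subgroup generated by the set `T` of generators. -/
def CoxeterSystem.parabolicInvariants {B : Type*} {M : CoxeterMatrix B} {W : Type*} [Group W]
    (cs : CoxeterSystem M W) {K A : Type*} [CommRing K] [AddCommGroup A] [Module K A]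
    (ρ : Representation K W A) (T : Finset B) : Submodule K A :=
  Representation.invariants
    (MonoidHom.comp ρ (Subgroup.closure (cs.simple '' (T : Set B))).subtype)

theorem CoxeterSystem.mem_parabolicInvariants {B : Type*} {M : CoxeterMatrix B} {W : Type*}
    [Group W] (cs : CoxeterSystem M W) {K A : Type*} [CommRing K] [AddCommGroup A] [Module K A]
    (ρ : Representation K W A) (T : Finset B) (v : A) :
    v ∈ cs.parabolicInvariants ρ T ↔ ∀ t ∈ T, ρ (cs.simple t) v = v := by
  constructor
  · intro h t ht
    exact h ⟨cs.simple t, Subgroup.subset_closure ⟨t, ht, rfl⟩⟩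
  · rintro h ⟨g, hg⟩
    change ρ g v = v
    induction hg using Subgroup.closure_induction with
    | mem x hx => obtain ⟨t, ht, rfl⟩ := hx; exact h t ht
    | one => simp
    | mul x y _ _ hx hy => rw [map_mul, Module.End.mul_apply, hy, hx]
    | inv x _ hx =>
      conv_lhs => rw [← hx]
      rw [← Module.End.mul_apply, ← map_mul, inv_mul_cancel, map_one, Module.End.one_apply]

/-- The `k`-cochains `⨁ A^⟨T⟩`, over the `T ∈ I(S)` with `|T| = k`.  (For a finite
set of generators there are finitely many `T`, so the product below is the direct sum.) -/
abbrev CoxeterSystem.Cochain {B : Type*} {M : CoxeterMatrix B} {W : Type*} [Group W]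
    (cs : CoxeterSystem M W) {K A : Type*} [CommRing K] [AddCommGroup A] [Module K A]
    (ρ : Representation K W A) (k : ℕ) : Type _ :=
  ∀ T : M.IndepSets k, cs.parabolicInvariants ρ T.1

/-- Removing one element from an independent set. -/
def CoxeterMatrix.IndepSets.erase {B : Type*} [DecidableEq B] {M : CoxeterMatrix B} {k : ℕ}
    (U : M.IndepSets (k + 1)) (s : B) (hs : s ∈ U.1) : M.IndepSets k :=
  ⟨U.1.erase s, U.2.1.mono (by simp), by
    rw [Finset.card_erase_of_mem hs, U.2.2, Nat.add_sub_cancel]⟩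

/-- The sign `(-1) ^ |{t ∈ T | t < s}|`. -/
def coxeterSign {B : Type*} [LinearOrder B] (T : Finset B) (s : B) : ℤ :=
  (-1) ^ (T.filter (· < s)).card

theorem CoxeterMatrix.commute_simple {B : Type*} {M : CoxeterMatrix B} {W : Type*} [Group W]
    (cs : CoxeterSystem M W) {U : Set B} (hU : M.coxeterGraph.IsIndepSet U) {s t : B}
    (hs : s ∈ U) (ht : t ∈ U) : cs.simple s * cs.simple t = cs.simple t * cs.simple s := by
  rcases eq_or_ne s t with rfl | hst
  · rfl
  have h2 : M s t = 2 := by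
    by_contra h
    exact hU hs ht hst ⟨hst, h⟩
  have h := cs.simple_mul_simple_pow s t
  rw [h2, pow_two] at h
  have h' := eq_inv_of_mul_eq_one_left h
  rwa [mul_inv_rev, cs.inv_simple, cs.inv_simple] at h'

theorem CoxeterSystem.add_simple_mem {B : Type*} [DecidableEq B] {M : CoxeterMatrix B} {W : Type*}
    [Group W] (cs : CoxeterSystem M W) {K A : Type*} [CommRing K] [AddCommGroup A] [Module K A]
    (ρ : Representation K W A) {U : Finset B} (hU : M.coxeterGraph.IsIndepSet (U : Set B))
    {s : B} (hs : s ∈ U) {v : A} (hv : v ∈ cs.parabolicInvariants ρ (U.erase s)) :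
    v + ρ (cs.simple s) v ∈ cs.parabolicInvariants ρ U := by
  rw [CoxeterSystem.mem_parabolicInvariants] at hv ⊢
  intro t ht
  rcases eq_or_ne t s with rfl | hts
  · rw [map_add, ← Module.End.mul_apply, ← map_mul, cs.simple_mul_simple_self, map_one,
      Module.End.one_apply, add_comm]
  · have h := hv t (Finset.mem_erase.mpr ⟨hts, ht⟩)
    rw [map_add, ← Module.End.mul_apply, ← map_mul, CoxeterMatrix.commute_simple cs hU ht hs,
      map_mul, Module.End.mul_apply, h]

/-- The map `d_{T, s} : A^⟨T⟩ → A^⟨T ∪ {s}⟩`, `v ↦ (-1) ^ |{t ∈ T | t < s}| (v + s v)`, where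
`U = T ∪ {s} ∈ I(S)` and `T = U \ {s}`. -/
def CoxeterSystem.dComponent {B : Type*} [LinearOrder B] {M : CoxeterMatrix B} {W : Type*}
    [Group W] (cs : CoxeterSystem M W) {K A : Type*} [CommRing K] [AddCommGroup A] [Module K A]
    (ρ : Representation K W A) {k : ℕ} (U : M.IndepSets (k + 1)) (s : B) (hs : s ∈ U.1) :
    cs.parabolicInvariants ρ (U.erase s hs).1 →ₗ[K] cs.parabolicInvariants ρ U.1 :=
  coxeterSign (U.erase s hs).1 s •
    LinearMap.restrict (LinearMap.id + ρ (cs.simple s))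
      (fun _ hv => cs.add_simple_mem ρ U.2.1 hs hv)

theorem CoxeterSystem.coe_dComponent {B : Type*} [LinearOrder B] {M : CoxeterMatrix B} {W : Type*}
    [Group W] (cs : CoxeterSystem M W) {K A : Type*} [CommRing K] [AddCommGroup A] [Module K A]
    (ρ : Representation K W A) {k : ℕ} (U : M.IndepSets (k + 1)) (s : B) (hs : s ∈ U.1)
    (v : cs.parabolicInvariants ρ (U.erase s hs).1) :
    (cs.dComponent ρ U s hs v : A) =
      coxeterSign (U.1.erase s) s • ((v : A) + ρ (cs.simple s) (v : A)) := by
  rfl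

/-- The differential `∑ d_{T, s}`: its component at `U ∈ I(S)` is the sum over `s ∈ U` of the
`d_{T, s}` with `T = U \ {s}`. -/
def CoxeterSystem.d {B : Type*} [LinearOrder B] {M : CoxeterMatrix B} {W : Type*}
    [Group W] (cs : CoxeterSystem M W) {K A : Type*} [CommRing K] [AddCommGroup A] [Module K A]
    (ρ : Representation K W A) (k : ℕ) : cs.Cochain ρ k →ₗ[K] cs.Cochain ρ (k + 1) :=
  LinearMap.pi fun U => ∑ s : {s // s ∈ U.1},
    cs.dComponent ρ U s.1 s.2 ∘ₗ LinearMap.proj (U.erase s.1 s.2)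

theorem CoxeterSystem.coe_d_apply {B : Type*} [LinearOrder B] {M : CoxeterMatrix B} {W : Type*}
    [Group W] (cs : CoxeterSystem M W) {K A : Type*} [CommRing K] [AddCommGroup A] [Module K A]
    (ρ : Representation K W A) {k : ℕ} (f : cs.Cochain ρ k) (U : M.IndepSets (k + 1)) :
    (cs.d ρ k f U : A) = ∑ s : {s // s ∈ U.1}, coxeterSign (U.1.erase s.1) s.1 •
      ((f (U.erase s.1 s.2) : A) + ρ (cs.simple s.1) (f (U.erase s.1 s.2) : A)) := by
  simp [CoxeterSystem.d, CoxeterSystem.coe_dComponent]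

theorem coxeterSign_mul {B : Type*} [LinearOrder B] (U : Finset B) {s t : B} (hs : s ∈ U)
    (ht : t ∈ U) (hst : s ≠ t) :
    coxeterSign (U.erase s) s * coxeterSign ((U.erase s).erase t) t =
      - (coxeterSign (U.erase t) t * coxeterSign ((U.erase t).erase s) s) := by
  have aux : ∀ {s t : B}, s ∈ U → t ∈ U → s < t →
      coxeterSign (U.erase s) s * coxeterSign ((U.erase s).erase t) t =
        - (coxeterSign (U.erase t) t * coxeterSign ((U.erase t).erase s) s) := by
    intro s t hs ht h
    have e1 : (U.erase s).filter (· < s) = ((U.erase t).erase s).filter (· < s) := by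
      ext x; simp only [Finset.mem_filter, Finset.mem_erase]
      constructor
      · rintro ⟨⟨a, b⟩, c⟩; exact ⟨⟨a, (c.trans h).ne, b⟩, c⟩
      · rintro ⟨⟨a, -, b⟩, c⟩; exact ⟨⟨a, b⟩, c⟩
    have e2 : (U.erase t).filter (· < t) =
        insert s (((U.erase s).erase t).filter (· < t)) := by
      ext x; simp only [Finset.mem_filter, Finset.mem_erase, Finset.mem_insert]
      constructor
      · rintro ⟨⟨a, b⟩, c⟩
        by_cases hx : x = s
        · exact Or.inl hx
        · exact Or.inr ⟨⟨a, hx, b⟩, c⟩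
      · rintro (rfl | ⟨⟨a, -, b⟩, c⟩)
        · exact ⟨⟨h.ne, hs⟩, h⟩
        · exact ⟨⟨a, b⟩, c⟩
    have e3 : s ∉ ((U.erase s).erase t).filter (· < t) := by simp
    unfold coxeterSign
    rw [e1, e2, Finset.card_insert_of_notMem e3, pow_succ]
    ring
  rcases lt_or_gt_of_ne hst with h | h
  · exact aux hs ht h
  · rw [aux ht hs h, neg_neg]

theorem CoxeterSystem.d_comp_d {B : Type*} [LinearOrder B] {M : CoxeterMatrix B} {W : Type*}
    [Group W] (cs : CoxeterSystem M W) {K A : Type*} [CommRing K] [AddCommGroup A] [Module K A]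
    (ρ : Representation K W A) (k : ℕ) : cs.d ρ (k + 1) ∘ₗ cs.d ρ k = 0 := by
  ext f U
  rw [LinearMap.comp_apply, CoxeterSystem.coe_d_apply]
  simp only [CoxeterSystem.coe_d_apply, map_sum, map_zsmul, Finset.smul_sum,
    ← Finset.sum_add_distrib]
  rw [Finset.sum_sigma']
  refine Finset.sum_involution
    (fun x _ => ⟨⟨x.2.1, Finset.mem_of_mem_erase x.2.2⟩,
      ⟨x.1.1, Finset.mem_erase.mpr ⟨(Finset.ne_of_mem_erase x.2.2).symm, x.1.2⟩⟩⟩)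
    ?_ ?_ (fun _ _ => by simp) (fun _ _ => rfl)
  · rintro ⟨⟨s, hs⟩, ⟨t, ht⟩⟩ -
    have hts : t ≠ s := Finset.ne_of_mem_erase ht
    have htU : t ∈ U.1 := Finset.mem_of_mem_erase ht
    have hst : s ∈ U.1.erase t := Finset.mem_erase.mpr ⟨hts.symm, hs⟩
    have hE : (U.erase t htU).erase s hst = (U.erase s hs).erase t ht :=
      Subtype.ext Finset.erase_right_comm
    have hcomm : ρ (cs.simple s) ∘ₗ ρ (cs.simple t) = ρ (cs.simple t) ∘ₗ ρ (cs.simple s) := by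
      rw [← Module.End.mul_eq_comp, ← Module.End.mul_eq_comp, ← map_mul, ← map_mul,
        CoxeterMatrix.commute_simple cs U.2.1 hs htU]
    have hcomm' := fun v => LinearMap.congr_fun hcomm v
    simp only [LinearMap.comp_apply] at hcomm'
    dsimp only
    rw [hE]
    generalize ((f ((U.erase s hs).erase t ht)) : A) = v
    change coxeterSign (U.1.erase s) s • (coxeterSign ((U.1.erase s).erase t) t • _
      + coxeterSign ((U.1.erase s).erase t) t • _) +
      coxeterSign (U.1.erase t) t • (coxeterSign ((U.1.erase t).erase s) s • _
      + coxeterSign ((U.1.erase t).erase s) s • _) = 0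
    rw [← smul_add, ← smul_add, smul_smul, smul_smul, coxeterSign_mul U.1 hs htU hts.symm,
      map_add, map_add, hcomm' v]
    module
  · rintro ⟨⟨s, hs⟩, ⟨t, ht⟩⟩ - - h
    have := congrArg (fun x => x.1.1) h
    exact Finset.ne_of_mem_erase ht this

/-- The Coxeter cochain complex `X_C(G, A)`. -/
def CoxeterSystem.coxeterComplex {B : Type*} [LinearOrder B] {M : CoxeterMatrix B} {W : Type*}
    [Group W] (cs : CoxeterSystem M W) {K A : Type*} [CommRing K] [AddCommGroup A] [Module K A]
    (ρ : Representation K W A) : CochainComplex (ModuleCat K) ℕ :=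
  CochainComplex.of (fun k => ModuleCat.of K (cs.Cochain ρ k))
    (fun k => ModuleCat.ofHom (cs.d ρ k))
    (fun k => by rw [← ModuleCat.ofHom_comp, cs.d_comp_d]; rfl)

/-- The Coxeter cohomology `H^i_C(G, A)`. -/
def CoxeterSystem.coxeterCohomology {B : Type*} [LinearOrder B] {M : CoxeterMatrix B} {W : Type*}
    [Group W] (cs : CoxeterSystem M W) {K A : Type*} [CommRing K] [AddCommGroup A] [Module K A]
    (ρ : Representation K W A) (i : ℕ) : ModuleCat K :=
  (cs.coxeterComplex ρ).homology i

/-! ## The Betti numbers -/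

/-- The dimensions for the Coxeter graph that is a path with `n` vertices.  (In the last
case `1 ≤ i`.) -/
def bettiLinear (n i : ℕ) : ℕ :=
  if n = 3 * i then 2 * i
  else if n = 3 * i + 1 then i + 1
  else if n + 1 = 3 * i then i - 1
  else 0

/-- The dimensions for the Coxeter graph of type `D n`, `4 ≤ n`. -/
def bettiD (n i : ℕ) : ℕ :=
  if n = 3 * i then i + 1
  else if n = 3 * i + 1 then 2 * i + 1
  else if n = 3 * i + 2 then i
  else 0

end

/-!
The proof has two independent halves.

*Cohomology.*  Let `T` be an independent set of vertices of the Coxeter graph `Γ`.  The roots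
`α t`, `t ∈ T`, are orthonormal, so an invariant of the subgroup generated by `T` is determined by
its coordinates outside `T`, and these are arbitrary.  A reflection in `T` changes only
coordinates in `T`.  Hence, after scaling the `k`-cochains by `2⁻ᵏ`, the Coxeter complex with
coefficients in the reflection representation splits as the sum, over the vertices `u`, of the
augmented simplicial cochain complexes of the independence complexes of `Γ` without `u`
(`CoxeterSystem.nonempty_coxeterCohomology_equiv`).  The labels of `Γ` play no role here.

The graphs `Γ` without `u` are forests.  If the only neighbour of a vertex `w` is `x`, then the
deletion of `x` from the independence complex is a cone with apex `w`, and the long exact sequence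
identifies the cohomology with that of the link of `x`, shifted by one
(`SetFamily.finrank_cohomology_eq_link`).  Repeating this, one arrives at a cone or at the
complex of the empty graph, so that the independence complex is a point or a sphere as far as
cohomology is concerned; `SimpleGraph.IndepSphere` records the outcome.  A path with `l` vertices
gives a point for `l = 3 d + 1` and a sphere of dimension `d - 1` for `l = 3 d` and `l = 3 d - 1`,
and disjoint unions give joins (`SimpleGraph.IndepSphere.path`).  The Betti numbers count the
vertices `u` for which the sphere has the right dimension (`SimpleGraph.card_pathValue`,
`SimpleGraph.card_valueD`).

*Classification.*  Averaging an inner product over the finite group shows that no nonzero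
function `v` with values in `ℕ` satisfies `2 v i ≤ ∑ v j`, the sum over the neighbours `j` of `i`,
for all `i` (`CoxeterSystem.noSubharmonic`).  Such functions exist on the extended Dynkin diagrams,
so `Γ` contains none of these.  The constant `1` is not such a function either, which gives a
vertex with one neighbour; by induction, what is left without it is a path or of type `D` or
`E`, and a leaf can be added to these graphs only in such a way that the result is again one of
them (`SimpleGraph.NoSubharmonic.isPathOrDE`).
-/

noncomputable section

/-! ### Simplicial cochains of a family of finite sets -/

namespace SetFamily

variable {B : Type*} [LinearOrder B]

theorem coxeterSign_mul_self (T : Finset B) (s : B) :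
    (coxeterSign T s : ℝ) * coxeterSign T s = 1 := by
  rw [← Int.cast_mul, coxeterSign, ← mul_pow]
  simp

theorem coxeterSign_mul_cast {U : Finset B} {s t : B} (hs : s ∈ U) (ht : t ∈ U) (hst : s ≠ t) :
    (coxeterSign (U.erase s) s : ℝ) * coxeterSign ((U.erase s).erase t) t =
      - (coxeterSign (U.erase t) t * coxeterSign ((U.erase t).erase s) s) := by
  exact_mod_cast coxeterSign_mul U hs ht hst

/-- The real cochains of degree `k` on the family `F`: the functions that vanish at all sets
other than the members of `F` with `k` elements.  The empty set has degree `0`, so for a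
simplicial complex this is the augmented cochain complex, shifted by one.  The degree is an
integer, so that the cochains of degree `k - 1` make sense (and vanish) at `k = 0`. -/
def cochains (F : Set (Finset B)) (k : ℤ) : Submodule ℝ (Finset B → ℝ) where
  carrier := {f | ∀ T, f T ≠ 0 → T ∈ F ∧ (T.card : ℤ) = k}
  add_mem' := by
    intro f g hf hg T hT
    by_cases h : f T = 0
    · exact hg T fun h' => hT (by simp [h, h'])
    · exact hf T h
  zero_mem' := by simp
  smul_mem' := by
    intro c f hf T hT
    exact hf T fun h => hT (by simp [h])

open Classical in
/-- The simplicial coboundary on the family `F`. -/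
def coboundary (F : Set (Finset B)) : (Finset B → ℝ) →ₗ[ℝ] (Finset B → ℝ) where
  toFun f U := if U ∈ F then ∑ s ∈ U, (coxeterSign (U.erase s) s : ℝ) * f (U.erase s) else 0
  map_add' f g := by
    ext U
    by_cases h : U ∈ F <;> simp [h, mul_add, Finset.sum_add_distrib]
  map_smul' c f := by
    ext U
    by_cases h : U ∈ F <;> simp [h, Finset.mul_sum, mul_left_comm]

theorem coboundary_of_mem {F : Set (Finset B)} {U : Finset B} (hU : U ∈ F) (f : Finset B → ℝ) :
    coboundary F f U = ∑ s ∈ U, (coxeterSign (U.erase s) s : ℝ) * f (U.erase s) := by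
  simp [coboundary, hU]

theorem coboundary_of_notMem {F : Set (Finset B)} {U : Finset B} (hU : U ∉ F)
    (f : Finset B → ℝ) : coboundary F f U = 0 := by
  simp [coboundary, hU]

theorem coboundary_mem {F : Set (Finset B)} {k : ℤ} {f : Finset B → ℝ} (hf : f ∈ cochains F k) :
    coboundary F f ∈ cochains F (k + 1) := by
  intro U hU
  have hUF : U ∈ F := by
    by_contra h
    exact hU (coboundary_of_notMem h f)
  refine ⟨hUF, ?_⟩
  rw [coboundary_of_mem hUF] at hU
  obtain ⟨s, hs, hne⟩ := Finset.exists_ne_zero_of_sum_ne_zero hU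
  have := (hf _ (right_ne_zero_of_mul hne)).2
  rw [← this, ← Finset.card_erase_add_one hs]
  push_cast
  rfl

theorem coboundary_coboundary {F : Set (Finset B)} (hF : IsLowerSet F) (f : Finset B → ℝ) :
    coboundary F (coboundary F f) = 0 := by
  ext U
  by_cases hU : U ∈ F
  swap
  · exact coboundary_of_notMem hU _
  rw [coboundary_of_mem hU, Pi.zero_apply]
  have h1 : ∀ s ∈ U, (coxeterSign (U.erase s) s : ℝ) * coboundary F f (U.erase s) =
      ∑ t ∈ U.erase s, (coxeterSign (U.erase s) s : ℝ) *
        (coxeterSign ((U.erase s).erase t) t * f ((U.erase s).erase t)) := by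
    intro s _
    rw [coboundary_of_mem (hF (Finset.erase_subset s U) hU), Finset.mul_sum]
  rw [Finset.sum_congr rfl h1, Finset.sum_sigma']
  -- the terms for `(s, t)` and `(t, s)` cancel
  refine Finset.sum_involution (fun x _ => ⟨x.2, x.1⟩) ?_ ?_ ?_ (fun _ _ => rfl)
  · rintro ⟨s, t⟩ h
    simp only [Finset.mem_sigma, Finset.mem_erase] at h
    obtain ⟨hs, hts, ht⟩ := h
    have := coxeterSign_mul_cast hs ht hts.symm
    dsimp only
    rw [Finset.erase_right_comm (a := t) (b := s), ← mul_assoc, ← mul_assoc, this,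
      Finset.erase_right_comm (a := t) (b := s)]
    ring
  · rintro ⟨s, t⟩ h - heq
    simp only [Finset.mem_sigma, Finset.mem_erase] at h
    exact h.2.1 (congrArg Sigma.fst heq)
  · rintro ⟨s, t⟩ h
    simp only [Finset.mem_sigma, Finset.mem_erase] at h ⊢
    exact ⟨h.2.2, h.2.1.symm, h.1⟩

/-- The cocycles of degree `k` of the family `F`. -/
def cocycles (F : Set (Finset B)) (k : ℤ) : Submodule ℝ (Finset B → ℝ) :=
  cochains F k ⊓ LinearMap.ker (coboundary F)

/-- The coboundaries of degree `k` of the family `F`. -/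
def coboundaries (F : Set (Finset B)) (k : ℤ) : Submodule ℝ (Finset B → ℝ) :=
  (cochains F (k - 1)).map (coboundary F)

/-- The cohomology in degree `k` of the family `F`: for a simplicial complex, its reduced
simplicial cohomology in degree `k - 1`. -/
def cohomology (F : Set (Finset B)) (k : ℤ) : Type _ :=
  cocycles F k ⧸ (coboundaries F k).submoduleOf (cocycles F k)

instance (F : Set (Finset B)) (k : ℤ) : AddCommGroup (cohomology F k) :=
  inferInstanceAs (AddCommGroup (cocycles F k ⧸ (coboundaries F k).submoduleOf (cocycles F k)))

instance (F : Set (Finset B)) (k : ℤ) : Module ℝ (cohomology F k) :=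
  inferInstanceAs (Module ℝ (cocycles F k ⧸ (coboundaries F k).submoduleOf (cocycles F k)))

/-- The class of a cocycle. -/
def cohomologyClass (F : Set (Finset B)) (k : ℤ) : cocycles F k →ₗ[ℝ] cohomology F k :=
  ((coboundaries F k).submoduleOf (cocycles F k)).mkQ

theorem cohomologyClass_surjective (F : Set (Finset B)) (k : ℤ) :
    Function.Surjective (cohomologyClass F k) := Submodule.mkQ_surjective _

theorem cohomologyClass_eq_zero {F : Set (Finset B)} {k : ℤ} (z : cocycles F k) :
    cohomologyClass F k z = 0 ↔ (z : Finset B → ℝ) ∈ coboundaries F k :=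
  Submodule.Quotient.mk_eq_zero _

instance [Finite B] (F : Set (Finset B)) (k : ℤ) : Module.Finite ℝ (cohomology F k) :=
  Module.Finite.of_surjective _ (cohomologyClass_surjective F k)

theorem mem_cocycles {F : Set (Finset B)} {k : ℤ} {f : Finset B → ℝ} :
    f ∈ cocycles F k ↔ f ∈ cochains F k ∧ coboundary F f = 0 := by
  simp [cocycles]

theorem mem_coboundaries {F : Set (Finset B)} {k : ℤ} {f : Finset B → ℝ} :
    f ∈ coboundaries F k ↔ ∃ g ∈ cochains F (k - 1), coboundary F g = f := Iff.rfl

theorem finrank_cohomology_eq_zero {F : Set (Finset B)} {k : ℤ}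
    (h : cocycles F k ≤ coboundaries F k) : Module.finrank ℝ (cohomology F k) = 0 := by
  have : Subsingleton (cohomology F k) := subsingleton_of_forall_eq 0 fun q => by
    obtain ⟨z, rfl⟩ := cohomologyClass_surjective F k q
    exact (cohomologyClass_eq_zero z).2 (h z.2)
  exact Module.finrank_zero_of_subsingleton

/-- A linear map onto the cocycles modulo coboundaries, the kernel of which is known, computes the
dimension of the cohomology. -/
theorem finrank_cohomology_eq {F : Set (Finset B)} {k : ℤ} {Z : Type*} [AddCommGroup Z]
    [Module ℝ Z] {P : Submodule ℝ Z} (φ : Z →ₗ[ℝ] cocycles F k)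
    (h₁ : ∀ y, (φ y : Finset B → ℝ) ∈ coboundaries F k ↔ y ∈ P)
    (h₂ : ∀ f ∈ cocycles F k, ∃ y, f - φ y ∈ coboundaries F k) :
    Module.finrank ℝ (cohomology F k) = Module.finrank ℝ (Z ⧸ P) := by
  have hker : LinearMap.ker (cohomologyClass F k ∘ₗ φ) = P := by
    ext y
    rw [LinearMap.mem_ker, LinearMap.comp_apply, cohomologyClass_eq_zero, h₁]
  have hsurj : Function.Surjective (cohomologyClass F k ∘ₗ φ) := by
    intro q
    obtain ⟨z, rfl⟩ := cohomologyClass_surjective F k q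
    obtain ⟨y, hy⟩ := h₂ z z.2
    refine ⟨y, ?_⟩
    rw [LinearMap.comp_apply, ← sub_eq_zero, ← map_sub, cohomologyClass_eq_zero]
    simpa using Submodule.neg_mem _ hy
  rw [← hker]
  exact (LinearMap.quotKerEquivOfSurjective _ hsurj).finrank_eq.symm

/-! ### Cones, and removing a vertex with acyclic complement -/

/-- A simplicial complex that is a cone with apex `w` is acyclic. -/
theorem cocycles_le_coboundaries_of_cone {F : Set (Finset B)} (hF : IsLowerSet F) {w : B}
    (hw : ∀ T ∈ F, insert w T ∈ F) (k : ℤ) : cocycles F k ≤ coboundaries F k := by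
  intro f hf
  obtain ⟨hf, hδ⟩ := mem_cocycles.1 hf
  -- the contracting homotopy
  let g : Finset B → ℝ := fun T => if w ∈ T then 0 else coxeterSign T w * f (insert w T)
  have hg : ∀ T, w ∉ T → g T = coxeterSign T w * f (insert w T) := fun T hT => if_neg hT
  have hg' : ∀ T, w ∈ T → g T = 0 := fun T hT => if_pos hT
  refine ⟨g, ?_, ?_⟩
  · intro T hT
    have hwT : w ∉ T := fun h => hT (hg' T h)
    rw [hg T hwT] at hT
    obtain ⟨h1, h2⟩ := hf _ (right_ne_zero_of_mul hT)
    refine ⟨hF (Finset.subset_insert w T) h1, ?_⟩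
    rw [Finset.card_insert_of_notMem hwT] at h2
    push_cast at h2
    linarith
  · ext U
    by_cases hU : U ∈ F
    swap
    · rw [coboundary_of_notMem hU]
      by_contra h
      exact hU (hf U (Ne.symm h)).1
    rw [coboundary_of_mem hU]
    by_cases hwU : w ∈ U
    · rw [Finset.sum_eq_single_of_mem w hwU]
      · rw [hg _ (Finset.notMem_erase w U), Finset.insert_erase hwU, ← mul_assoc,
          coxeterSign_mul_self, one_mul]
      · intro s _ hs
        rw [hg' _ (Finset.mem_erase.2 ⟨hs.symm, hwU⟩), mul_zero]
    · have h0 := congrFun hδ (insert w U)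
      rw [coboundary_of_mem (hw U hU), Finset.sum_insert hwU, Finset.erase_insert hwU,
        Pi.zero_apply] at h0
      have h1 : ∀ s ∈ U, (coxeterSign (U.erase s) s : ℝ) * g (U.erase s) =
          - (coxeterSign U w * (coxeterSign ((insert w U).erase s) s *
            f ((insert w U).erase s))) := by
        intro s hs
        have hsw : s ≠ w := fun h => hwU (h ▸ hs)
        have e1 : (insert w U).erase s = insert w (U.erase s) :=
          Finset.erase_insert_of_ne hsw.symm
        have hw' : w ∉ U.erase s := fun h => hwU (Finset.mem_of_mem_erase h)
        have h2 := coxeterSign_mul_cast (Finset.mem_insert_of_mem hs : s ∈ insert w U)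
          (Finset.mem_insert_self w U) hsw
        rw [Finset.erase_insert hwU, e1, Finset.erase_insert hw'] at h2
        rw [hg _ hw', e1]
        have h3 := coxeterSign_mul_self U w
        have h4 := coxeterSign_mul_self (U.erase s) w
        linear_combination (f (insert w (U.erase s))) *
          (- (coxeterSign (U.erase s) s : ℝ) * coxeterSign (U.erase s) w * h3
            - coxeterSign (insert w (U.erase s)) s * coxeterSign U w * h4
            + coxeterSign U w * coxeterSign (U.erase s) w * h2)
      rw [Finset.sum_congr rfl h1, Finset.sum_neg_distrib, ← Finset.mul_sum]
      have h3 := coxeterSign_mul_self U w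
      linear_combination f U * h3 - coxeterSign U w * h0

/-- The link of a vertex in a simplicial complex. -/
def link (F : Set (Finset B)) (x : B) : Set (Finset B) := {T | x ∉ T ∧ insert x T ∈ F}

/-- The deletion of a vertex from a simplicial complex. -/
def deletion (F : Set (Finset B)) (x : B) : Set (Finset B) := {T | T ∈ F ∧ x ∉ T}

/-- The map that takes a cochain of the link of `x` to the cochain supported on the sets that
contain `x`. -/
def ofLink (x : B) : (Finset B → ℝ) →ₗ[ℝ] (Finset B → ℝ) where
  toFun f T := if x ∈ T then coxeterSign (T.erase x) x * f (T.erase x) else 0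
  map_add' f g := by
    ext T
    by_cases h : x ∈ T <;> simp [h, mul_add]
  map_smul' c f := by
    ext T
    by_cases h : x ∈ T <;> simp [h, mul_left_comm]

theorem ofLink_of_mem {x : B} {T : Finset B} (h : x ∈ T) (f : Finset B → ℝ) :
    ofLink x f T = coxeterSign (T.erase x) x * f (T.erase x) := by simp [ofLink, h]

theorem ofLink_of_notMem {x : B} {T : Finset B} (h : x ∉ T) (f : Finset B → ℝ) :
    ofLink x f T = 0 := by simp [ofLink, h]

theorem ofLink_mem {F : Set (Finset B)} {x : B} {k : ℤ} {f : Finset B → ℝ}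
    (hf : f ∈ cochains (link F x) (k - 1)) : ofLink x f ∈ cochains F k := by
  intro T hT
  by_cases h : x ∈ T
  · rw [ofLink_of_mem h] at hT
    obtain ⟨h1, h2⟩ := hf _ (right_ne_zero_of_mul hT)
    refine ⟨by simpa [Finset.insert_erase h] using h1.2, ?_⟩
    rw [← Finset.card_erase_add_one h]
    push_cast
    linarith
  · exact absurd (ofLink_of_notMem h f) hT

theorem coboundary_ofLink (F : Set (Finset B)) (x : B) (f : Finset B → ℝ) :
    coboundary F (ofLink x f) = - ofLink x (coboundary (link F x) f) := by
  ext U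
  by_cases hxU : x ∈ U
  swap
  · rw [Pi.neg_apply, ofLink_of_notMem hxU, neg_zero]
    by_cases hU : U ∈ F
    · rw [coboundary_of_mem hU]
      refine Finset.sum_eq_zero fun s _ => ?_
      rw [ofLink_of_notMem (fun h => hxU (Finset.mem_of_mem_erase h)), mul_zero]
    · exact coboundary_of_notMem hU _
  have hiff : U.erase x ∈ link F x ↔ U ∈ F := by simp [link, Finset.insert_erase hxU]
  rw [Pi.neg_apply, ofLink_of_mem hxU]
  by_cases hU : U ∈ F
  swap
  · rw [coboundary_of_notMem hU, coboundary_of_notMem (hiff.not.2 hU), mul_zero, neg_zero]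
  rw [coboundary_of_mem hU, coboundary_of_mem (hiff.2 hU), ← Finset.add_sum_erase U _ hxU,
    ofLink_of_notMem (Finset.notMem_erase x U), mul_zero, zero_add, Finset.mul_sum,
    ← Finset.sum_neg_distrib]
  refine Finset.sum_congr rfl fun s hs => ?_
  obtain ⟨hsx, hs⟩ := Finset.mem_erase.1 hs
  rw [ofLink_of_mem (Finset.mem_erase.2 ⟨hsx.symm, hxU⟩), ← mul_assoc,
    coxeterSign_mul_cast hs hxU hsx, Finset.erase_right_comm (a := s) (b := x)]
  ring

/-- A cochain that vanishes at the sets without `x` comes from the link of `x`. -/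
theorem exists_ofLink_eq {F : Set (Finset B)} {x : B} {k : ℤ} {f : Finset B → ℝ}
    (hf : f ∈ cochains F k) (h : ∀ T, x ∉ T → f T = 0) :
    ∃ y ∈ cochains (link F x) (k - 1), ofLink x y = f := by
  refine ⟨fun T => if x ∈ T then 0 else coxeterSign T x * f (insert x T), ?_, ?_⟩
  · intro T hT
    by_cases hx : x ∈ T
    · simp [hx] at hT
    · simp only [hx, if_false] at hT
      obtain ⟨h1, h2⟩ := hf _ (right_ne_zero_of_mul hT)
      rw [Finset.card_insert_of_notMem hx] at h2
      push_cast at h2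
      exact ⟨⟨hx, h1⟩, by linarith⟩
  · ext T
    by_cases hx : x ∈ T
    · rw [ofLink_of_mem hx]
      simp only [Finset.notMem_erase, if_false, Finset.insert_erase hx]
      rw [← mul_assoc, coxeterSign_mul_self, one_mul]
    · rw [ofLink_of_notMem hx, h T hx]

theorem eq_zero_of_ofLink_eq_zero {F : Set (Finset B)} {x : B} {k : ℤ} {y : Finset B → ℝ}
    (hy : y ∈ cochains (link F x) k) (h : ofLink x y = 0) : y = 0 := by
  ext T
  by_contra hT
  have hx := (hy T hT).1.1
  have := congrFun h (insert x T)
  rw [ofLink_of_mem (Finset.mem_insert_self x T), Finset.erase_insert hx, Pi.zero_apply] at this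
  rcases mul_eq_zero.1 this with h0 | h0
  · have h1 := coxeterSign_mul_self T x
    rw [h0] at h1
    simp at h1
  · exact hT h0

/-- If the deletion of `x` is acyclic, a cochain whose coboundary vanishes at the sets without `x`
can be changed by a coboundary so that it vanishes at these sets itself. -/
theorem exists_sub_coboundary {F : Set (Finset B)} {x : B}
    (hac : ∀ k, cocycles (deletion F x) k ≤ coboundaries (deletion F x) k) {k : ℤ}
    {f : Finset B → ℝ} (hf : f ∈ cochains F k) (hδ : ∀ T, x ∉ T → coboundary F f T = 0) :
    ∃ g ∈ cochains F (k - 1), ∀ T, x ∉ T → (f - coboundary F g) T = 0 := by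
  have hrest : ∀ (h : Finset B → ℝ) (U : Finset B), x ∉ U →
      coboundary (deletion F x) h U = coboundary F h U := by
    intro h U hx
    by_cases hU : U ∈ F
    · rw [coboundary_of_mem hU, coboundary_of_mem (show U ∈ deletion F x from ⟨hU, hx⟩)]
    · rw [coboundary_of_notMem hU,
        coboundary_of_notMem (show U ∉ deletion F x from fun h => hU h.1)]
  let r : Finset B → ℝ := fun T => if x ∈ T then 0 else f T
  have hr : ∀ T, x ∉ T → r T = f T := fun T hT => if_neg hT
  have hr' : r ∈ cocycles (deletion F x) k := by
    refine mem_cocycles.2 ⟨?_, ?_⟩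
    · intro T hT
      by_cases hx : x ∈ T
      · simp [r, hx] at hT
      · rw [hr T hx] at hT
        exact ⟨⟨(hf T hT).1, hx⟩, (hf T hT).2⟩
    · ext U
      by_cases hx : x ∈ U
      · exact coboundary_of_notMem (fun h => h.2 hx) _
      · rw [hrest _ _ hx, Pi.zero_apply, ← hδ U hx]
        by_cases hU : U ∈ F
        · rw [coboundary_of_mem hU, coboundary_of_mem hU]
          refine Finset.sum_congr rfl fun s _ => ?_
          rw [hr _ fun h => hx (Finset.mem_of_mem_erase h)]
        · rw [coboundary_of_notMem hU, coboundary_of_notMem hU]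
  obtain ⟨g, hg, hgr⟩ := mem_coboundaries.1 (hac k hr')
  refine ⟨g, fun T hT => ⟨(hg T hT).1.1, (hg T hT).2⟩, fun T hx => ?_⟩
  rw [Pi.sub_apply, ← hrest g T hx, hgr, hr T hx, sub_self]

/-- If the deletion of `x` is acyclic, the cohomology is that of the link of `x`, with a shift:
this is the long exact sequence of the pair. -/
theorem finrank_cohomology_eq_link {F : Set (Finset B)} (hF : IsLowerSet F) {x : B}
    (hac : ∀ k, cocycles (deletion F x) k ≤ coboundaries (deletion F x) k) (k : ℤ) :
    Module.finrank ℝ (cohomology F k) = Module.finrank ℝ (cohomology (link F x) (k - 1)) := by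
  have hφ : ∀ y ∈ cocycles (link F x) (k - 1), ofLink x y ∈ cocycles F k := by
    intro y hy
    obtain ⟨h1, h2⟩ := mem_cocycles.1 hy
    exact mem_cocycles.2 ⟨ofLink_mem h1, by rw [coboundary_ofLink, h2, map_zero, neg_zero]⟩
  refine finrank_cohomology_eq
    (P := (coboundaries (link F x) (k - 1)).submoduleOf (cocycles (link F x) (k - 1)))
    ((ofLink x).restrict hφ) ?_ ?_
  · rintro ⟨y, hy⟩
    obtain ⟨hy1, hy2⟩ := mem_cocycles.1 hy
    simp only [Submodule.submoduleOf, Submodule.mem_comap, Submodule.subtype_apply,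
      LinearMap.coe_restrict_apply]
    constructor
    · intro h
      obtain ⟨g, hg, hgy⟩ := mem_coboundaries.1 h
      obtain ⟨g', hg', hz⟩ := exists_sub_coboundary hac hg fun T hT => by
        rw [hgy, ofLink_of_notMem hT]
      have hmem : g - coboundary F g' ∈ cochains F (k - 1) :=
        Submodule.sub_mem _ hg (by simpa using coboundary_mem hg')
      obtain ⟨y', hy', he⟩ := exists_ofLink_eq hmem hz
      refine mem_coboundaries.2 ⟨-y', Submodule.neg_mem _ hy', ?_⟩
      rw [← sub_eq_zero]
      refine eq_zero_of_ofLink_eq_zero (F := F) (k := k - 1) (Submodule.sub_mem _ ?_ hy1) ?_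
      · simpa using coboundary_mem (Submodule.neg_mem _ hy')
      · rw [map_sub, map_neg, map_neg, ← coboundary_ofLink, he, map_sub,
          coboundary_coboundary hF, hgy, sub_zero, sub_self]
    · intro h
      obtain ⟨g, hg, rfl⟩ := mem_coboundaries.1 h
      refine mem_coboundaries.2 ⟨-ofLink x g, Submodule.neg_mem _ (ofLink_mem hg), ?_⟩
      rw [map_neg, coboundary_ofLink, neg_neg]
  · intro f hf
    obtain ⟨hf1, hf2⟩ := mem_cocycles.1 hf
    obtain ⟨g, hg, hz⟩ := exists_sub_coboundary hac hf1 fun T _ => by rw [hf2, Pi.zero_apply]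
    have hmem : f - coboundary F g ∈ cochains F k :=
      Submodule.sub_mem _ hf1 (by simpa using coboundary_mem hg)
    obtain ⟨y, hy, he⟩ := exists_ofLink_eq hmem hz
    have hyc : y ∈ cocycles (link F x) (k - 1) := by
      refine mem_cocycles.2 ⟨hy, eq_zero_of_ofLink_eq_zero (coboundary_mem hy) ?_⟩
      rw [← neg_eq_zero, ← coboundary_ofLink, he, map_sub, hf2, coboundary_coboundary hF, sub_zero]
    refine ⟨⟨y, hyc⟩, ?_⟩
    simp only [LinearMap.coe_restrict_apply, he]
    exact mem_coboundaries.2 ⟨g, hg, by abel⟩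

/-- The family whose only member is the empty set has cohomology of dimension one, in degree
zero. -/
theorem finrank_cohomology_singleton_empty (k : ℤ) :
    Module.finrank ℝ (cohomology ({∅} : Set (Finset B)) k) = if k = 0 then 1 else 0 := by
  have hδ : ∀ f : Finset B → ℝ, coboundary ({∅} : Set (Finset B)) f = 0 := by
    intro f
    ext U
    by_cases hU : U = ∅
    · rw [coboundary_of_mem (by simpa using hU), hU]
      simp
    · exact coboundary_of_notMem (by simpa using hU) _
  split_ifs with hk
  · subst hk
    refine (finrank_cohomology_eq (P := ⊥)
      (LinearMap.codRestrict _ (LinearMap.single ℝ (fun _ : Finset B => ℝ) ∅) fun c => by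
        refine mem_cocycles.2 ⟨fun T hT => ?_, hδ _⟩
        have : T = ∅ := by
          by_contra h
          exact hT (by simp [h])
        simp [this]) ?_ ?_).trans (by
          rw [(Submodule.quotEquivOfEqBot _ rfl).finrank_eq, Module.finrank_self])
    · intro y
      simp only [Submodule.mem_bot]
      constructor
      · intro h
        obtain ⟨g, -, hg⟩ := mem_coboundaries.1 h
        rw [hδ] at hg
        simpa using (congrFun hg ∅).symm
      · rintro rfl
        simp
    · intro f hf
      refine ⟨f ∅, ?_⟩
      have hs : f = Pi.single ∅ (f ∅) := by
        ext T
        by_cases hT : T = ∅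
        · subst hT
          simp
        · have : f T = 0 := by
            by_contra h
            exact hT (by simpa using ((mem_cocycles.1 hf).1 T h).1)
          simp [this, hT]
      rw [LinearMap.codRestrict_apply, LinearMap.coe_single]
      rw [← hs, sub_self]
      exact Submodule.zero_mem _
  · refine finrank_cohomology_eq_zero fun f hf => ?_
    have : f = 0 := by
      ext T
      by_contra hT
      obtain ⟨h1, h2⟩ := (mem_cocycles.1 hf).1 T hT
      rw [Set.mem_singleton_iff] at h1
      subst h1
      exact hk (by simpa using h2.symm)
    rw [this]
    exact Submodule.zero_mem _

end SetFamily

end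

/-! ### Independence complexes -/

namespace SimpleGraph

open SetFamily

/-- The independence complex of the subgraph of `G` induced on `A`. -/
def indepComplex {V : Type*} (G : SimpleGraph V) (A : Finset V) : Set (Finset V) :=
  {T | T ⊆ A ∧ G.IsIndepSet (T : Set V)}

theorem isLowerSet_indepComplex {V : Type*} (G : SimpleGraph V) (A : Finset V) :
    IsLowerSet (G.indepComplex A) := fun _ _ hle h =>
  ⟨hle.trans h.1, h.2.mono (Finset.coe_subset.2 hle)⟩

theorem indepComplex_empty {V : Type*} (G : SimpleGraph V) : G.indepComplex ∅ = {∅} := by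
  ext T
  simp only [indepComplex, Set.mem_ofPred_eq, Finset.subset_empty, Set.mem_singleton_iff,
    and_iff_left_iff_imp]
  rintro rfl
  simp [IsIndepSet]

theorem isIndepSet_insert_iff {V : Type*} [DecidableEq V] {G : SimpleGraph V} {x : V}
    {T : Finset V} : G.IsIndepSet ((insert x T : Finset V) : Set V) ↔
      G.IsIndepSet (T : Set V) ∧ ∀ y ∈ T, ¬ G.Adj x y := by
  rw [Finset.coe_insert, IsIndepSet, Set.pairwise_insert]
  refine and_congr_right fun _ => forall₂_congr fun y _ => ?_
  constructor
  · intro h hadj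
    exact (h hadj.ne).1 hadj
  · intro h _
    exact ⟨h, fun h' => h h'.symm⟩

theorem cocycles_le_coboundaries_of_isolated {V : Type*} [LinearOrder V] {G : SimpleGraph V}
    {A : Finset V} {w : V} (hw : w ∈ A) (h : ∀ y ∈ A, ¬ G.Adj w y) (k : ℤ) :
    cocycles (G.indepComplex A) k ≤ coboundaries (G.indepComplex A) k :=
  cocycles_le_coboundaries_of_cone (G.isLowerSet_indepComplex A)
    (fun _ hT => ⟨Finset.insert_subset hw hT.1,
      isIndepSet_insert_iff.2 ⟨hT.2, fun y hy => h y (hT.1 hy)⟩⟩) k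

/-- `G.IndepSphere A m` says that folding leaves shows the independence complex of `G` on `A` to
have the homotopy type of a point, for `m = none`, or of a sphere of dimension `d - 1`, for
`m = some d`. -/
inductive IndepSphere {V : Type*} (G : SimpleGraph V) : Finset V → Option ℕ → Prop
  | empty : IndepSphere G ∅ (some 0)
  | isolated {A : Finset V} (w : V) (hw : w ∈ A) (h : ∀ y ∈ A, ¬ G.Adj w y) :
      IndepSphere G A none
  | fold {A A' : Finset V} {m : Option ℕ} (w x : V) (hw : w ∈ A) (hx : x ∈ A) (hwx : w ≠ x)
      (h : ∀ y ∈ A, G.Adj w y → y = x) (hA' : ∀ y, y ∈ A' ↔ y ∈ A ∧ y ≠ x ∧ ¬ G.Adj x y)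
      (hm : IndepSphere G A' m) : IndepSphere G A (m.map (· + 1))

theorem IndepSphere.of_iso {V V' : Type*} {G : SimpleGraph V} {H : SimpleGraph V'} (e : G ≃g H)
    {A : Finset V'} {m : Option ℕ} (h : H.IndepSphere A m) :
    ∀ A' : Finset V, (∀ y, y ∈ A' ↔ e y ∈ A) → G.IndepSphere A' m := by
  induction h with
  | empty =>
    intro A' hA'
    have : A' = ∅ := Finset.eq_empty_of_forall_notMem fun y hy => by simpa using (hA' y).1 hy
    exact this ▸ .empty
  | isolated w hw h =>
    intro A' hA'
    refine .isolated (e.symm w) (by simpa [hA'] using hw) fun y hy hadj => ?_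
    exact h (e y) ((hA' y).1 hy) (by simpa using e.map_adj_iff.2 hadj)
  | @fold A A₁ m w x hw hx hwx h hA₁ _ ih =>
    intro A' hA'
    refine .fold (A' := A₁.map e.symm.toEquiv.toEmbedding) (e.symm w) (e.symm x)
      (by simpa [hA'] using hw)
      (by simpa [hA'] using hx) (by simpa using hwx) (fun y hy hadj => ?_) (fun y => ?_)
      (ih _ fun y => ?_)
    · have := h (e y) ((hA' y).1 hy) (by simpa using e.map_adj_iff.2 hadj)
      simp [← this]
    · have h1 : y ∈ A₁.map e.symm.toEquiv.toEmbedding ↔ e y ∈ A₁ := by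
        rw [Finset.mem_map_equiv]
        rfl
      have h2 : H.Adj x (e y) ↔ G.Adj (e.symm x) y := by
        rw [← e.map_adj_iff, e.apply_symm_apply]
      have h3 : y = e.symm x ↔ e y = x := by
        constructor
        · rintro rfl
          simp
        · rintro rfl
          simp
      rw [h1, hA₁, hA', h2, Ne, Ne, h3]
    · rw [Finset.mem_map_equiv]
      rfl

theorem link_indepComplex {V : Type*} [LinearOrder V] {G : SimpleGraph V} {A A' : Finset V} {x : V}
    (hx : x ∈ A) (hA' : ∀ y, y ∈ A' ↔ y ∈ A ∧ y ≠ x ∧ ¬ G.Adj x y) :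
    link (G.indepComplex A) x = G.indepComplex A' := by
  ext T
  simp only [link, indepComplex, Set.mem_ofPred_eq, isIndepSet_insert_iff, Finset.insert_subset_iff]
  constructor
  · rintro ⟨h1, ⟨-, h2⟩, h3, h4⟩
    exact ⟨fun y hy => (hA' y).2 ⟨h2 hy, fun h => h1 (h ▸ hy), h4 y hy⟩, h3⟩
  · rintro ⟨h1, h2⟩
    exact ⟨fun h => ((hA' x).1 (h1 h)).2.1 rfl, ⟨hx, fun y hy => ((hA' y).1 (h1 hy)).1⟩, h2,
      fun y hy => ((hA' y).1 (h1 hy)).2.2⟩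

theorem deletion_indepComplex {V : Type*} [LinearOrder V] (G : SimpleGraph V) (A : Finset V)
    (x : V) : deletion (G.indepComplex A) x = G.indepComplex (A.erase x) := by
  ext T
  simp only [deletion, indepComplex, Set.mem_ofPred_eq, Finset.subset_erase]
  tauto

/-- In the fold step the deletion of `x` is a cone with apex the leaf `w`, so only the link of `x`
contributes. -/
theorem IndepSphere.finrank_cohomology {V : Type*} [LinearOrder V] {G : SimpleGraph V}
    {A : Finset V} {m : Option ℕ} (h : G.IndepSphere A m) : ∀ k : ℤ,
    Module.finrank ℝ (cohomology (G.indepComplex A) k) =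
      if m.map (Nat.cast : ℕ → ℤ) = some k then 1 else 0 := by
  induction h with
  | empty =>
    intro k
    rw [indepComplex_empty, finrank_cohomology_singleton_empty]
    simp [eq_comm]
  | isolated w hw h =>
    intro k
    rw [finrank_cohomology_eq_zero (cocycles_le_coboundaries_of_isolated hw h k)]
    simp
  | @fold A A' m w x hw hx hwx h hA' _ ih =>
    intro k
    rw [finrank_cohomology_eq_link (G.isLowerSet_indepComplex A) (x := x), link_indepComplex hx hA',
      ih]
    · cases m with
      | none => simp
      | some d => simp [eq_sub_iff_add_eq]
    · intro k
      rw [deletion_indepComplex]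
      refine cocycles_le_coboundaries_of_isolated (Finset.mem_erase.2 ⟨hwx, hw⟩)
        (fun y hy hadj => ?_) k
      exact (Finset.mem_erase.1 hy).1 (h y (Finset.mem_of_mem_erase hy) hadj)

/-- The homotopy type of the independence complex of a path with `l` vertices: a point for
`l = 3 d + 1`, and a sphere of dimension `d - 1` for `l = 3 d` and `l = 3 d - 1`.  The values have
the meaning that they have in `SimpleGraph.IndepSphere`. -/
def pathSphere (l : ℕ) : Option ℕ :=
  if l % 3 = 0 then some (l / 3) else if l % 3 = 1 then none else some (l / 3 + 1)

theorem pathSphere_add_three (l : ℕ) : pathSphere (l + 3) = (pathSphere l).map (· + 1) := by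
  simp only [pathSphere, Nat.add_mod_right]
  split_ifs <;> simp

theorem pathSphere_eq_some {l i : ℕ} : pathSphere l = some i ↔ l = 3 * i ∨ l + 1 = 3 * i := by
  unfold pathSphere
  split_ifs
  · rw [Option.some.injEq]
    omega
  · simp only [false_iff]
    omega
  · rw [Option.some.injEq]
    omega

/-- A path that forms a component of its own joins a sphere to the independence complex. -/
theorem IndepSphere.path {V : Type*} {G : SimpleGraph V} {A' : Finset V} {m : Option ℕ}
    (h : G.IndepSphere A' m) (p : ℕ → V) (l : ℕ) :
    (∀ i < l, ∀ j < l, p i = p j → i = j) →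
    (∀ i < l, ∀ j < l, (G.Adj (p i) (p j) ↔ i + 1 = j ∨ j + 1 = i)) →
    (∀ i < l, p i ∉ A') → (∀ i < l, ∀ y ∈ A', ¬ G.Adj (p i) y) →
    ∀ A : Finset V, (∀ y, y ∈ A ↔ y ∈ A' ∨ ∃ i < l, p i = y) →
    G.IndepSphere A (Option.map₂ (· + ·) m (pathSphere l)) := by
  induction l using Nat.strong_induction_on with
  | h l ih =>
  intro inj adj hd hn A hA
  have hp : ∀ i < l, p i ∈ A := fun i hi => (hA _).2 (Or.inr ⟨i, hi, rfl⟩)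
  rcases l with _ | _ | l
  · have : A = A' := by
      ext y
      simp [hA]
    rw [this]
    cases m <;> simpa [pathSphere] using h
  · have : Option.map₂ (· + ·) m (pathSphere 1) = none := by simp [pathSphere]
    rw [zero_add, this]
    refine .isolated (p 0) (hp 0 (by omega)) fun y hy => ?_
    rcases (hA y).1 hy with hy | ⟨i, hi, rfl⟩
    · exact hn 0 (by omega) y hy
    · rw [adj 0 (by omega) i hi]
      omega
  -- fold the last vertex of the path onto the one before
  have hlast : ∀ y ∈ A, G.Adj (p (l + 1)) y → y = p l := by
    intro y hy hadj
    rcases (hA y).1 hy with hy | ⟨i, hi, rfl⟩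
    · exact absurd hadj (hn _ (by omega) y hy)
    · rw [adj _ (by omega) i hi] at hadj
      congr 1
      omega
  have hne : p (l + 1) ≠ p l := fun h => by
    have := inj _ (by omega) _ (by omega) h
    omega
  rcases l with _ | l
  · have : Option.map₂ (· + ·) m (pathSphere 2) = m.map (· + 1) := by
      cases m <;> simp [pathSphere]
    rw [zero_add, this]
    refine .fold (p 1) (p 0) (hp _ (by omega)) (hp _ (by omega)) hne hlast (fun y => ?_) h
    constructor
    · exact fun hy => ⟨(hA y).2 (Or.inl hy), fun h => hd 0 (by omega) (h ▸ hy),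
        hn 0 (by omega) y hy⟩
    · rintro ⟨h1, h2, h3⟩
      rcases (hA y).1 h1 with hy | ⟨i, hi, rfl⟩
      · exact hy
      · rw [adj 0 (by omega) i hi] at h3
        have : i = 0 := by omega
        exact absurd (this ▸ rfl) h2
  · have : Option.map₂ (· + ·) m (pathSphere (l + 3)) =
        (Option.map₂ (· + ·) m (pathSphere l)).map (· + 1) := by
      rw [pathSphere_add_three]
      cases m <;> cases pathSphere l <;> simp [add_assoc]
    rw [this]
    classical
    refine .fold (A' := A' ∪ (Finset.range l).image p) (p (l + 2)) (p (l + 1)) (hp _ (by omega))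
      (hp _ (by omega)) hne hlast (fun y => ?_) ?_
    · simp only [Finset.mem_union, Finset.mem_image, Finset.mem_range]
      constructor
      · rintro (hy | ⟨i, hi, rfl⟩)
        · exact ⟨(hA y).2 (Or.inl hy), fun h => hd (l + 1) (by omega) (h ▸ hy),
            hn (l + 1) (by omega) y hy⟩
        · refine ⟨hp i (by omega), fun h => ?_, ?_⟩
          · have := inj _ (by omega) _ (by omega) h
            omega
          · rw [adj _ (by omega) _ (by omega)]
            omega
      · rintro ⟨h1, h2, h3⟩
        rcases (hA y).1 h1 with hy | ⟨i, hi, rfl⟩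
        · exact Or.inl hy
        · rw [adj _ (by omega) i hi] at h3
          have : i ≠ l + 1 := fun h => h2 (h ▸ rfl)
          exact Or.inr ⟨i, by omega, rfl⟩
    · exact ih l (by omega) (fun i hi j hj => inj i (by omega) j (by omega))
        (fun i hi j hj => adj i (by omega) j (by omega)) (fun i hi => hd i (by omega))
        (fun i hi => hn i (by omega)) _ fun y => by simp

end SimpleGraph

noncomputable section

/-! ### The Coxeter complex of the reflection representation -/

open SetFamily

/-- Homology of a short complex of modules, from a map on cycles that is onto and whose kernel
consists of the boundaries. -/
theorem CategoryTheory.ShortComplex.nonempty_homology_equiv {R N : Type*} [Ring R]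
    [AddCommGroup N] [Module R N] (S : ShortComplex (ModuleCat R))
    (Φ : LinearMap.ker S.g.hom →ₗ[R] N) (hsurj : Function.Surjective Φ)
    (hker : ∀ z, Φ z = 0 ↔ ∃ y, S.f.hom y = (z : S.X₂)) : Nonempty (S.homology ≃ₗ[R] N) := by
  have hk : LinearMap.range S.moduleCatToCycles = LinearMap.ker Φ := by
    ext z
    rw [LinearMap.mem_ker, hker, LinearMap.mem_range]
    exact exists_congr fun y => Subtype.ext_iff
  exact ⟨S.moduleCatHomologyIso.toLinearEquiv ≪≫ₗ
    Submodule.quotEquivOfEq _ _ hk ≪≫ₗ Φ.quotKerEquivOfSurjective hsurj⟩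

/-- An independent set of `k` vertices, as a member of `I(S)`. -/
def CoxeterMatrix.IndepSets.mk {B : Type*} {M : CoxeterMatrix B} {k : ℕ} (T : Finset B)
    (h : M.coxeterGraph.IsIndepSet (T : Set B)) (hc : T.card = k) : M.IndepSets k := ⟨T, h, hc⟩

theorem CoxeterMatrix.gram_eq_zero_of_indep {B : Type*} {M : CoxeterMatrix B} {T : Finset B}
    (hT : M.coxeterGraph.IsIndepSet (T : Set B)) {s t : B} (hs : s ∈ T) (ht : t ∈ T)
    (hst : s ≠ t) : M.gram s t = 0 := by
  have h2 : M s t = 2 := by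
    by_contra h
    exact hT hs ht hst ⟨hst, h⟩
  simp [CoxeterMatrix.gram, h2]

variable {B : Type*} [Fintype B] [LinearOrder B] {M : CoxeterMatrix B} {W : Type*} [Group W]

theorem CoxeterSystem.mem_parabolicInvariants_reflectionRep (cs : CoxeterSystem M W)
    (T : Finset B) (v : B → ℝ) :
    v ∈ cs.parabolicInvariants cs.reflectionRep T ↔ ∀ t ∈ T, M.simpleCoroot t v = 0 := by
  rw [cs.mem_parabolicInvariants]
  refine forall₂_congr fun t _ => ?_
  rw [cs.reflectionRep_simple, sub_eq_self, smul_eq_zero, or_iff_left]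
  simp

theorem CoxeterMatrix.simpleCoroot_eq_of_indep {T : Finset B}
    (hT : M.coxeterGraph.IsIndepSet (T : Set B)) {t : B} (ht : t ∈ T) (v : B → ℝ) :
    M.simpleCoroot t v = 2 * v t + ∑ u ∈ Tᶜ, 2 * M.gram t u * v u := by
  rw [M.simpleCoroot_apply, ← Finset.sum_add_sum_compl T, Finset.sum_eq_single_of_mem t ht]
  · simp [CoxeterMatrix.gram]
  · intro s hs hst
    rw [M.gram_eq_zero_of_indep hT ht hs hst.symm]
    simp

/-- An invariant of the subgroup generated by `T` is determined by its coordinates outside `T`. -/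
theorem CoxeterSystem.eq_zero_of_mem_parabolicInvariants (cs : CoxeterSystem M W) {T : Finset B}
    (hT : M.coxeterGraph.IsIndepSet (T : Set B)) {v : B → ℝ}
    (hv : v ∈ cs.parabolicInvariants cs.reflectionRep T) (h0 : ∀ u ∉ T, v u = 0) : v = 0 := by
  rw [cs.mem_parabolicInvariants_reflectionRep] at hv
  ext t
  by_cases ht : t ∈ T
  · have := hv t ht
    rw [M.simpleCoroot_eq_of_indep hT ht, Finset.sum_eq_zero fun u hu => by
      rw [h0 u (Finset.mem_compl.1 hu), mul_zero]] at this
    simpa using this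
  · exact h0 t ht

/-- The coordinates outside `T` of an invariant of the subgroup generated by `T` are arbitrary. -/
theorem CoxeterSystem.exists_mem_parabolicInvariants (cs : CoxeterSystem M W) {T : Finset B}
    (hT : M.coxeterGraph.IsIndepSet (T : Set B)) (a : B → ℝ) :
    ∃ v ∈ cs.parabolicInvariants cs.reflectionRep T, ∀ u ∉ T, v u = a u := by
  refine ⟨fun t => if t ∈ T then - ∑ u ∈ Tᶜ, M.gram t u * a u else a t, ?_, fun u hu => by
    simp [hu]⟩
  rw [cs.mem_parabolicInvariants_reflectionRep]
  intro t ht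
  rw [M.simpleCoroot_eq_of_indep hT ht]
  simp only [ht, if_true]
  have h : ∀ u ∈ Tᶜ, 2 * M.gram t u * (if u ∈ T then - ∑ u' ∈ Tᶜ, M.gram u u' * a u' else a u) =
      2 * (M.gram t u * a u) := by
    intro u hu
    rw [if_neg (Finset.mem_compl.1 hu)]
    ring
  rw [Finset.sum_congr rfl h, ← Finset.mul_sum]
  ring

/-- The coordinate `u` of a cochain with values in the reflection representation, as a simplicial
cochain on the independence complex of the graph without `u`.  The factor absorbs the scalar by
which the two differentials differ. -/
def CoxeterSystem.toSimplicial (cs : CoxeterSystem M W) (k : ℕ) (u : B) :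
    cs.Cochain cs.reflectionRep k →ₗ[ℝ] (Finset B → ℝ) := by
  classical
  exact
  { toFun f T := if h : M.coxeterGraph.IsIndepSet (T : Set B) ∧ T.card = k then
      if u ∈ T then 0 else (2⁻¹ : ℝ) ^ k * (f (.mk T h.1 h.2) : B → ℝ) u else 0
    map_add' f g := by
      ext T
      by_cases h : M.coxeterGraph.IsIndepSet (T : Set B) ∧ T.card = k
      · by_cases hu : u ∈ T
        · simp [hu]
        · simp only [dif_pos h, if_neg hu, Pi.add_apply]
          exact mul_add _ _ _
      · simp [h]
    map_smul' c f := by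
      ext T
      by_cases h : M.coxeterGraph.IsIndepSet (T : Set B) ∧ T.card = k
      · by_cases hu : u ∈ T
        · simp [hu]
        · simp only [dif_pos h, if_neg hu, Pi.smul_apply]
          exact mul_left_comm _ _ _
      · simp [h] }

theorem CoxeterSystem.toSimplicial_apply (cs : CoxeterSystem M W) {k : ℕ} {u : B}
    (f : cs.Cochain cs.reflectionRep k) (T : M.IndepSets k) (hu : u ∉ T.1) :
    cs.toSimplicial k u f T.1 = (2⁻¹ : ℝ) ^ k * (f T : B → ℝ) u := by
  have : M.coxeterGraph.IsIndepSet (T.1 : Set B) ∧ T.1.card = k := T.2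
  simp only [CoxeterSystem.toSimplicial, LinearMap.coe_mk, AddHom.coe_mk, dif_pos this, if_neg hu]
  rfl

theorem CoxeterSystem.toSimplicial_mem (cs : CoxeterSystem M W) {k : ℕ} (u : B)
    (f : cs.Cochain cs.reflectionRep k) :
    cs.toSimplicial k u f ∈ cochains (M.coxeterGraph.indepComplex (Finset.univ.erase u)) k := by
  intro T hT
  by_cases h : M.coxeterGraph.IsIndepSet (T : Set B) ∧ T.card = k
  · by_cases hu : u ∈ T
    · simp [CoxeterSystem.toSimplicial, hu] at hT
    · refine ⟨⟨fun y hy => ?_, h.1⟩, by exact_mod_cast h.2⟩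
      simp only [Finset.mem_erase, Finset.mem_univ, and_true]
      rintro rfl
      exact hu hy
  · simp [CoxeterSystem.toSimplicial, h] at hT

/-- The reflections in `T` change only the coordinates in `T`, so that coordinate by coordinate
the differential is, up to the factor `2`, the simplicial coboundary. -/
theorem CoxeterSystem.toSimplicial_d (cs : CoxeterSystem M W) {k : ℕ} (u : B)
    (f : cs.Cochain cs.reflectionRep k) :
    cs.toSimplicial (k + 1) u (cs.d cs.reflectionRep k f) =
      coboundary (M.coxeterGraph.indepComplex (Finset.univ.erase u)) (cs.toSimplicial k u f) := by
  ext U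
  by_cases hU : U ∈ M.coxeterGraph.indepComplex (Finset.univ.erase u) ∧ U.card = k + 1
  · obtain ⟨hU, hc⟩ := hU
    have hu : u ∉ U := fun h => by simpa using hU.1 h
    have hU2 := hU.2
    have hl := cs.toSimplicial_apply (cs.d cs.reflectionRep k f) (.mk U hU2 hc) hu
    change cs.toSimplicial (k + 1) u _ U = _ at hl
    rw [coboundary_of_mem hU, hl, cs.coe_d_apply, Finset.sum_apply, Finset.mul_sum,
      ← Finset.sum_attach U]
    refine Finset.sum_congr rfl fun s _ => ?_
    have hus : u ≠ s.1 := fun h => hu (h ▸ s.2)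
    have := cs.toSimplicial_apply (u := u) f
      (CoxeterMatrix.IndepSets.erase (.mk U hU2 hc) s.1 s.2)
      (fun h => hu (Finset.mem_of_mem_erase h))
    change cs.toSimplicial k u f (U.erase s.1) = _ at this
    rw [this, cs.reflectionRep_simple]
    simp only [Pi.smul_apply, Pi.add_apply, Pi.sub_apply, smul_eq_mul, zsmul_eq_mul,
      Pi.single_eq_of_ne hus]
    change _ * ((coxeterSign (U.erase s.1) s.1 : ℝ) * _) = _
    rw [pow_succ]
    ring
  · have h1 : cs.toSimplicial (k + 1) u (cs.d cs.reflectionRep k f) U = 0 := by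
      by_contra h
      have := cs.toSimplicial_mem u _ U h
      exact hU ⟨this.1, by exact_mod_cast this.2⟩
    have h2 : coboundary (M.coxeterGraph.indepComplex (Finset.univ.erase u))
        (cs.toSimplicial k u f) U = 0 := by
      by_contra h
      have := coboundary_mem (cs.toSimplicial_mem u f) U h
      exact hU ⟨this.1, by exact_mod_cast this.2⟩
    rw [h1, h2]

theorem CoxeterSystem.toSimplicial_injective (cs : CoxeterSystem M W) {k : ℕ}
    {f : cs.Cochain cs.reflectionRep k} (h : ∀ u, cs.toSimplicial k u f = 0) : f = 0 := by
  ext1 T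
  refine Subtype.ext (cs.eq_zero_of_mem_parabolicInvariants T.2.1 (f T).2 fun u hu => ?_)
  have := congrFun (h u) T.1
  rw [cs.toSimplicial_apply f T hu] at this
  simpa using this

theorem CoxeterSystem.toSimplicial_surjective (cs : CoxeterSystem M W) {k : ℕ}
    (g : B → Finset B → ℝ)
    (hg : ∀ u, g u ∈ cochains (M.coxeterGraph.indepComplex (Finset.univ.erase u)) k) :
    ∃ f : cs.Cochain cs.reflectionRep k, ∀ u, cs.toSimplicial k u f = g u := by
  choose v hv hvu using fun T : M.IndepSets k =>
    cs.exists_mem_parabolicInvariants T.2.1 fun u => (2 : ℝ) ^ k * g u T.1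
  refine ⟨fun T => ⟨v T, hv T⟩, fun u => ?_⟩
  ext T
  by_cases h : M.coxeterGraph.IsIndepSet (T : Set B) ∧ T.card = k ∧ u ∉ T
  · have hl := cs.toSimplicial_apply (fun T => ⟨v T, hv T⟩) (.mk T h.1 h.2.1) h.2.2
    have hr := hvu (.mk T h.1 h.2.1) u h.2.2
    change cs.toSimplicial k u _ T = _ * v _ u at hl
    rw [hl, hr]
    change _ * (_ * g u T) = _
    rw [← mul_assoc, ← mul_pow]
    norm_num
  · have hT : ∀ g' ∈ cochains (M.coxeterGraph.indepComplex (Finset.univ.erase u)) k, g' T = 0 := by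
      intro g' hg'
      by_contra h'
      obtain ⟨h1, h2⟩ := hg' T h'
      exact h ⟨h1.2, by exact_mod_cast h2, fun hu => by simpa using h1.1 hu⟩
    rw [hT _ (cs.toSimplicial_mem u _), hT _ (hg u)]

/-- In degree zero there are no coboundaries on either side. -/
theorem CoxeterSystem.toSimplicial_mem_coboundaries_zero (cs : CoxeterSystem M W)
    (z : cs.Cochain cs.reflectionRep 0) :
    (∀ u, cs.toSimplicial 0 u z ∈
      coboundaries (M.coxeterGraph.indepComplex (Finset.univ.erase u)) (0 : ℕ)) ↔ z = 0 := by
  constructor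
  · intro h
    refine cs.toSimplicial_injective fun u => ?_
    obtain ⟨g, hg, hgz⟩ := mem_coboundaries.1 (h u)
    have : g = 0 := by
      ext T
      by_contra hT
      have := (hg T hT).2
      omega
    rw [← hgz, this, map_zero]
  · rintro rfl u
    rw [map_zero]
    exact Submodule.zero_mem _

theorem CoxeterSystem.toSimplicial_mem_coboundaries_succ (cs : CoxeterSystem M W) {i : ℕ}
    (z : cs.Cochain cs.reflectionRep (i + 1)) :
    (∀ u, cs.toSimplicial (i + 1) u z ∈
      coboundaries (M.coxeterGraph.indepComplex (Finset.univ.erase u)) (i + 1 : ℕ)) ↔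
      ∃ y, cs.d cs.reflectionRep i y = z := by
  constructor
  · intro h
    choose g hg hgz using fun u => mem_coboundaries.1 (h u)
    obtain ⟨f, hf⟩ := cs.toSimplicial_surjective (k := i) g fun u => by
      simpa using hg u
    refine ⟨f, ?_⟩
    rw [← sub_eq_zero]
    refine cs.toSimplicial_injective fun u => ?_
    rw [map_sub, cs.toSimplicial_d, hf, hgz, sub_self]
  · rintro ⟨y, rfl⟩ u
    rw [cs.toSimplicial_d]
    exact mem_coboundaries.2 ⟨_, by simpa using cs.toSimplicial_mem u y, rfl⟩

/-- The Coxeter cohomology of the reflection representation is the sum over the vertices `u` of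
the reduced cohomology of the independence complexes of the graph without `u`. -/
theorem CoxeterSystem.nonempty_coxeterCohomology_equiv (cs : CoxeterSystem M W) (i : ℕ) :
    Nonempty (cs.coxeterCohomology cs.reflectionRep i ≃ₗ[ℝ]
      ∀ u : B, cohomology (M.coxeterGraph.indepComplex (Finset.univ.erase u)) (i : ℤ)) := by
  let F : B → Set (Finset B) := fun u => M.coxeterGraph.indepComplex (Finset.univ.erase u)
  let K := cs.coxeterComplex cs.reflectionRep
  have hd : ∀ k, (K.d k (k + 1)).hom = cs.d cs.reflectionRep k := fun k => by
    simp only [K, CoxeterSystem.coxeterComplex, CochainComplex.of_d]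
    rfl
  have hc : ∀ (u : B) (z : LinearMap.ker (K.d i (i + 1)).hom),
      cs.toSimplicial i u z.1 ∈ cocycles (F u) i := by
    intro u z
    refine mem_cocycles.2 ⟨cs.toSimplicial_mem u _, ?_⟩
    have hz : cs.d cs.reflectionRep i z.1 = 0 := by
      rw [← hd]
      exact z.2
    exact (cs.toSimplicial_d u z.1).symm.trans (by rw [hz, map_zero])
  let Φ : LinearMap.ker (K.d i (i + 1)).hom →ₗ[ℝ] ∀ u : B, cohomology (F u) (i : ℤ) :=
    LinearMap.pi fun u => cohomologyClass (F u) i ∘ₗ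
      LinearMap.codRestrict (cocycles (F u) i)
        (cs.toSimplicial i u ∘ₗ (LinearMap.ker (K.d i (i + 1)).hom).subtype) (hc u)
  have hΦ : ∀ z, Φ z = 0 ↔ ∀ u, cs.toSimplicial i u z.1 ∈ coboundaries (F u) i := by
    intro z
    rw [funext_iff]
    refine forall_congr' fun u => ?_
    simp only [Φ, LinearMap.pi_apply, LinearMap.comp_apply, Pi.zero_apply]
    exact cohomologyClass_eq_zero _
  suffices h : Function.Surjective Φ ∧
      ∀ z, Φ z = 0 ↔ ∃ y, (K.d ((ComplexShape.up ℕ).prev i) i).hom y = (z : K.X i) from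
    ((K.sc' ((ComplexShape.up ℕ).prev i) i (i + 1)).nonempty_homology_equiv
      (N := ∀ u : B, cohomology (F u) (i : ℤ)) Φ h.1 h.2).map fun E =>
        (K.homologyIsoSc' _ i (i + 1) rfl (by simp)).toLinearEquiv ≪≫ₗ E
  constructor
  · intro q
    choose g hg using fun u => cohomologyClass_surjective _ _ (q u)
    obtain ⟨f, hf⟩ := cs.toSimplicial_surjective (fun u => (g u).1)
      fun u => (mem_cocycles.1 (g u).2).1
    have hz : cs.d cs.reflectionRep i f = 0 := cs.toSimplicial_injective fun u => by
      rw [cs.toSimplicial_d, hf]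
      exact (mem_cocycles.1 (g u).2).2
    refine ⟨⟨f, (LinearMap.congr_fun (hd i) f).trans hz⟩, ?_⟩
    ext1 u
    rw [← hg u]
    exact congrArg _ (Subtype.ext (hf u))
  · intro z
    rw [hΦ]
    rcases i with _ | i
    · have hp : (K.d ((ComplexShape.up ℕ).prev 0) 0).hom = 0 := by
        rw [K.shape _ _ (by simp)]
        rfl
      refine (cs.toSimplicial_mem_coboundaries_zero z.1).trans ⟨fun h => ⟨0, ?_⟩, ?_⟩
      · rw [map_zero]
        exact h.symm
      · rintro ⟨y, hy⟩
        rw [← hy, hp]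
        rfl
    · have hp : (ComplexShape.up ℕ).prev (i + 1) = i := by simp
      rw [hp]
      exact (cs.toSimplicial_mem_coboundaries_succ z.1).trans
        (exists_congr fun y => ⟨(LinearMap.congr_fun (hd i) y).trans,
          (LinearMap.congr_fun (hd i) y).symm.trans⟩)

/-- The dimension of the Coxeter cohomology of the reflection representation, when the
independence complexes of the graph without one vertex are points and spheres. -/
theorem CoxeterSystem.nonempty_coxeterCohomology_equiv_fin (cs : CoxeterSystem M W) {n : ℕ}
    {H : SimpleGraph (Fin n)} (e : M.coxeterGraph ≃g H) (val : Fin n → Option ℕ)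
    (hval : ∀ u, H.IndepSphere (Finset.univ.erase u) (val u)) (i : ℕ) :
    Nonempty (cs.coxeterCohomology cs.reflectionRep i ≃ₗ[ℝ]
      (Fin (Finset.univ.filter fun u => val u = some i).card → ℝ)) := by
  obtain ⟨E⟩ := cs.nonempty_coxeterCohomology_equiv i
  refine ⟨E ≪≫ₗ LinearEquiv.ofFinrankEq _ _ ?_⟩
  rw [Module.finrank_pi_fintype, Module.finrank_fin_fun, Finset.card_filter,
    ← e.toEquiv.sum_comp]
  refine Finset.sum_congr rfl fun u _ => ?_
  have h := (hval (e u)).of_iso e (Finset.univ.erase u) fun y => by simp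
  rw [h.finrank_cohomology]
  change _ = if val (e u) = some i then 1 else 0
  cases val (e u) <;> simp

end

/-! ### Deleting a vertex from a path or a branched path -/

namespace SimpleGraph

theorem pathGraph_adj_iff {n : ℕ} {i j : Fin n} :
    (pathGraph n).Adj i j ↔ (i : ℕ) + 1 = j ∨ (j : ℕ) + 1 = i := pathGraph_adj

/-- A path on consecutive numbers that forms a component of its own joins a sphere to the
independence complex. -/
theorem IndepSphere.interval {n : ℕ} {H : SimpleGraph (Fin n)} {A' : Finset (Fin n)}
    {m : Option ℕ} (h : H.IndepSphere A' m) (a l : ℕ) (hl : a + l ≤ n)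
    (adj : ∀ i j : Fin n, a ≤ i → (i : ℕ) < a + l → a ≤ j → (j : ℕ) < a + l →
      (H.Adj i j ↔ (i : ℕ) + 1 = j ∨ (j : ℕ) + 1 = i))
    (hd : ∀ i ∈ A', ¬ (a ≤ (i : ℕ) ∧ (i : ℕ) < a + l))
    (hn : ∀ i : Fin n, a ≤ i → (i : ℕ) < a + l → ∀ y ∈ A', ¬ H.Adj i y) (A : Finset (Fin n))
    (hA : ∀ y : Fin n, y ∈ A ↔ y ∈ A' ∨ (a ≤ (y : ℕ) ∧ (y : ℕ) < a + l)) :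
    H.IndepSphere A (Option.map₂ (· + ·) m (pathSphere l)) := by
  rcases Nat.eq_zero_or_pos n with rfl | hpos
  · have h1 : A = A' := Subsingleton.elim _ _
    have h2 : l = 0 := by omega
    subst h1 h2
    cases m <;> simpa [pathSphere] using h
  -- the minimum only serves to stay within `Fin n`
  let p : ℕ → Fin n := fun i => ⟨min (a + i) (n - 1), by omega⟩
  have hp : ∀ i < l, ((p i : Fin n) : ℕ) = a + i := fun i hi => by
    simp only [p]
    omega
  refine h.path p l ?_ ?_ ?_ ?_ A ?_
  · intro i hi j hj hij
    have := congrArg Fin.val hij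
    rw [hp i hi, hp j hj] at this
    omega
  · intro i hi j hj
    rw [adj _ _ (by rw [hp i hi]; omega) (by rw [hp i hi]; omega) (by rw [hp j hj]; omega)
      (by rw [hp j hj]; omega), hp i hi, hp j hj]
    omega
  · intro i hi hmem
    exact hd _ hmem (by rw [hp i hi]; omega)
  · intro i hi
    exact hn _ (by rw [hp i hi]; omega) (by rw [hp i hi]; omega)
  · intro y
    rw [hA]
    refine or_congr Iff.rfl ⟨fun hy => ?_, ?_⟩
    · exact ⟨y - a, by omega, Fin.ext (by rw [hp _ (by omega)]; omega)⟩
    · rintro ⟨i, hi, rfl⟩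
      rw [hp i hi]
      omega

/-- Two paths on consecutive numbers that are components of their own. -/
theorem IndepSphere.two_intervals {n : ℕ} {H : SimpleGraph (Fin n)} (a l b l' : ℕ)
    (hab : a + l < b) (hl : b + l' ≤ n)
    (adj : ∀ i j : Fin n, (a ≤ i ∧ (i : ℕ) < a + l ∨ b ≤ i ∧ (i : ℕ) < b + l') →
      (a ≤ j ∧ (j : ℕ) < a + l ∨ b ≤ j ∧ (j : ℕ) < b + l') →
      (H.Adj i j ↔ (i : ℕ) + 1 = j ∨ (j : ℕ) + 1 = i)) (A : Finset (Fin n))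
    (hA : ∀ y : Fin n, y ∈ A ↔ (a ≤ y ∧ (y : ℕ) < a + l ∨ b ≤ y ∧ (y : ℕ) < b + l')) :
    H.IndepSphere A (Option.map₂ (· + ·) (pathSphere l) (pathSphere l')) := by
  have h1 : H.IndepSphere (Finset.univ.filter fun y : Fin n => a ≤ y ∧ (y : ℕ) < a + l)
      (Option.map₂ (· + ·) (some 0) (pathSphere l)) :=
    IndepSphere.empty.interval a l (by omega) (fun i j h1 h2 h3 h4 => adj i j (by omega) (by omega))
      (by simp) (by simp) _ (by simp)
  have h2 : Option.map₂ (· + ·) (some 0) (pathSphere l) = pathSphere l := by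
    cases pathSphere l <;> simp
  rw [h2] at h1
  refine h1.interval b l' hl (fun i j h1 h2 h3 h4 => adj i j (by omega) (by omega)) ?_ ?_ A ?_
  · intro i hi
    simp only [Finset.mem_filter, Finset.mem_univ, true_and] at hi
    omega
  · intro i h1 h2 y hy
    simp only [Finset.mem_filter, Finset.mem_univ, true_and] at hy
    rw [adj i y (by omega) (by omega)]
    omega
  · intro y
    simp [hA]

/-- The homotopy type of the independence complex of a path with `n` vertices without the vertex
`u`. -/
def pathValue (n u : ℕ) : Option ℕ :=
  Option.map₂ (· + ·) (pathSphere u) (pathSphere (n - 1 - u))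

theorem indepSphere_pathGraph {n : ℕ} (u : Fin n) :
    (pathGraph n).IndepSphere (Finset.univ.erase u) (pathValue n u) := by
  refine .two_intervals 0 u (u + 1) (n - 1 - u) (by omega) (by omega)
    (fun i j _ _ => pathGraph_adj_iff) _ fun y => ?_
  simp only [Finset.mem_erase, Finset.mem_univ, and_true, Ne, Fin.ext_iff]
  omega

theorem branchedPath_adj {k n : ℕ} {i j : Fin n} : (branchedPath k n).Adj i j ↔
    i ≠ j ∧ ((((i : ℕ) + 1 = j ∧ (j : ℕ) + 1 < n) ∨ ((i : ℕ) = k ∧ (j : ℕ) + 1 = n)) ∨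
      (((j : ℕ) + 1 = i ∧ (i : ℕ) + 1 < n) ∨ ((j : ℕ) = k ∧ (i : ℕ) + 1 = n))) := by
  rw [branchedPath, fromRel_adj]

theorem branchedPath_adj_of_lt {k n : ℕ} {i j : Fin n} (hi : (i : ℕ) + 1 < n)
    (hj : (j : ℕ) + 1 < n) :
    (branchedPath k n).Adj i j ↔ (i : ℕ) + 1 = j ∨ (j : ℕ) + 1 = i := by
  rw [branchedPath_adj, Ne, Fin.ext_iff]
  omega

/-- Without the additional vertex, a path remains. -/
theorem indepSphere_branchedPath_last {k n : ℕ} (u : Fin n) (hu : (u : ℕ) + 1 = n) :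
    (branchedPath k n).IndepSphere (Finset.univ.erase u) (pathSphere (n - 1)) := by
  have h2 : Option.map₂ (· + ·) (some 0) (pathSphere (n - 1)) = pathSphere (n - 1) := by
    cases pathSphere (n - 1) <;> simp
  rw [← h2]
  refine IndepSphere.empty.interval 0 (n - 1) (by omega)
    (fun i j _ _ _ _ => branchedPath_adj_of_lt (by omega) (by omega)) (by simp) (by simp) _
    fun y => ?_
  simp only [Finset.mem_erase, Finset.mem_univ, and_true, Ne, Fin.ext_iff, Finset.notMem_empty,
    false_or]
  omega

/-- Without its neighbour, the additional vertex is isolated. -/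
theorem indepSphere_branchedPath_branch {k n : ℕ} (hk : k + 1 < n) (u : Fin n) (hu : (u : ℕ) = k) :
    (branchedPath k n).IndepSphere (Finset.univ.erase u) none := by
  refine .isolated ⟨n - 1, by omega⟩ ?_ fun y hy => ?_
  · simp only [Finset.mem_erase, Finset.mem_univ, and_true, Ne, Fin.ext_iff]
    omega
  · simp only [Finset.mem_erase, Finset.mem_univ, and_true, Ne, Fin.ext_iff] at hy
    rw [branchedPath_adj, Ne, Fin.ext_iff]
    simp only
    omega

/-- Folding the additional vertex onto its neighbour `k`. -/
theorem indepSphere_branchedPath_fold {k n : ℕ} (hk : k + 1 < n) (u : Fin n) (hu : (u : ℕ) ≠ k)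
    (hu' : (u : ℕ) + 1 ≠ n) {A : Finset (Fin n)} {m : Option ℕ}
    (hA : ∀ y : Fin n, y ∈ A ↔
      y ≠ u ∧ (y : ℕ) + 1 < n ∧ ((y : ℕ) + 1 < k ∨ k + 1 < (y : ℕ)))
    (h : (branchedPath k n).IndepSphere A m) :
    (branchedPath k n).IndepSphere (Finset.univ.erase u) (m.map (· + 1)) := by
  refine .fold (A' := A) ⟨n - 1, by omega⟩ ⟨k, by omega⟩ ?_ ?_ ?_ (fun y _ => ?_) (fun y => ?_) h
  · simp only [Finset.mem_erase, Finset.mem_univ, and_true, Ne, Fin.ext_iff]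
    omega
  · simp only [Finset.mem_erase, Finset.mem_univ, and_true, Ne, Fin.ext_iff]
    omega
  · simp only [Ne, Fin.ext_iff]
    omega
  · rw [branchedPath_adj]
    simp only [Ne, Fin.ext_iff]
    omega
  · rw [hA, branchedPath_adj]
    simp only [Finset.mem_erase, Finset.mem_univ, and_true, true_and, Ne, Fin.ext_iff]
    omega

/-- The homotopy type of the independence complex of the graph of type `D n` without the vertex
`u`. -/
def valueD (n u : ℕ) : Option ℕ :=
  if u + 1 = n then pathSphere (n - 1) else if u = 1 then none
  else if u ≤ 2 then (pathSphere (n - 4)).map (· + 1)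
  else (Option.map₂ (· + ·) (pathSphere (u - 3)) (pathSphere (n - 2 - u))).map (· + 1)

theorem indepSphere_graphD {n : ℕ} (hn : 4 ≤ n) (u : Fin n) :
    (graphD n).IndepSphere (Finset.univ.erase u) (valueD n u) := by
  unfold valueD graphD
  split_ifs with h1 h2 h3
  · exact indepSphere_branchedPath_last u h1
  · exact indepSphere_branchedPath_branch (by omega) u h2
  · have h4 : pathSphere (n - 4) = Option.map₂ (· + ·) (some 0) (pathSphere (n - 4)) := by
      cases pathSphere (n - 4) <;> simp
    rw [h4]
    refine indepSphere_branchedPath_fold (A := Finset.univ.filter fun y : Fin n =>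
      3 ≤ (y : ℕ) ∧ (y : ℕ) < 3 + (n - 4)) (by omega) u h2 h1 (fun y => ?_)
      (IndepSphere.empty.interval 3 (n - 4) (by omega)
        (fun i j _ _ _ _ => branchedPath_adj_of_lt (by omega) (by omega)) (by simp) (by simp) _
        (by simp))
    simp only [Finset.mem_filter, Finset.mem_univ, true_and, Ne, Fin.ext_iff]
    omega
  · refine indepSphere_branchedPath_fold (A := Finset.univ.filter fun y : Fin n =>
      (3 ≤ (y : ℕ) ∧ (y : ℕ) < 3 + (u - 3) ∨ u + 1 ≤ (y : ℕ) ∧ (y : ℕ) < u + 1 + (n - 2 - u)))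
      (by omega) u h2 h1 (fun y => ?_)
      (.two_intervals 3 (u - 3) (u + 1) (n - 2 - u) (by omega) (by omega)
        (fun i j _ _ => branchedPath_adj_of_lt (by omega) (by omega)) _ (by simp))
    simp only [Finset.mem_filter, Finset.mem_univ, true_and, Ne, Fin.ext_iff]
    omega

/-- The homotopy type of the independence complex of the graph of type `E n` without the vertex
`u`. -/
def valueE (n u : ℕ) : Option ℕ :=
  if u + 1 = n then pathSphere (n - 1) else if u = 0 then (pathSphere (n - 5)).map (· + 1)
  else none

theorem indepSphere_graphE {n : ℕ} (hn : 5 ≤ n) (u : Fin n) :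
    (graphE n).IndepSphere (Finset.univ.erase u) (valueE n u) := by
  unfold valueE graphE
  split_ifs with h1 h2
  · exact indepSphere_branchedPath_last u h1
  · have h4 : pathSphere (n - 5) = Option.map₂ (· + ·) (some 0) (pathSphere (n - 5)) := by
      cases pathSphere (n - 5) <;> simp
    rw [h4]
    refine indepSphere_branchedPath_fold (A := Finset.univ.filter fun y : Fin n =>
      4 ≤ (y : ℕ) ∧ (y : ℕ) < 4 + (n - 5)) (by omega) u (by omega) h1 (fun y => ?_)
      (IndepSphere.empty.interval 4 (n - 5) (by omega)
        (fun i j _ _ _ _ => branchedPath_adj_of_lt (by omega) (by omega)) (by simp) (by simp) _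
        (by simp))
    simp only [Finset.mem_filter, Finset.mem_univ, true_and, Ne, Fin.ext_iff]
    omega
  · by_cases h3 : (u : ℕ) = 2
    · exact indepSphere_branchedPath_branch (by omega) u h3
    -- after the fold, the vertex `0` is isolated
    refine indepSphere_branchedPath_fold (m := none) (A := Finset.univ.filter fun y : Fin n =>
      y ≠ u ∧ (y : ℕ) + 1 < n ∧ ((y : ℕ) + 1 < 2 ∨ 2 + 1 < (y : ℕ))) (by omega) u h3 h1
      (by simp) (.isolated ⟨0, by omega⟩ ?_ fun y hy => ?_)
    · simp only [Finset.mem_filter, Finset.mem_univ, true_and, Ne, Fin.ext_iff]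
      omega
    · simp only [Finset.mem_filter, Finset.mem_univ, true_and, Ne, Fin.ext_iff] at hy
      rw [branchedPath_adj_of_lt (by simp only; omega) (by omega)]
      simp only
      omega

/-! ### Counting the spheres -/

theorem sum_pathValue (n : ℕ) : ∀ i : ℕ,
    (∑ u ∈ Finset.range n, if pathValue n u = some i then 1 else 0) = bettiLinear n i := by
  have hzero : ∀ n, (∑ u ∈ Finset.range n, if pathValue n u = some 0 then 1 else 0) =
      bettiLinear n 0 := by
    intro n
    have h1 : ∀ u ∈ Finset.range n, (if pathValue n u = some 0 then 1 else 0) =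
        if n = 1 then 1 else 0 := by
      intro u hu
      rw [Finset.mem_range] at hu
      have h0 : ∀ l, pathSphere l = some 0 ↔ l = 0 := fun l => by
        rw [pathSphere_eq_some]
        omega
      have h2 : pathValue n u = some 0 ↔ n = 1 := by
        simp only [pathValue, Option.map₂_eq_some_iff, Nat.add_eq_zero_iff, Option.mem_def]
        constructor
        · rintro ⟨a, b, ha, hb, rfl, rfl⟩
          rw [h0] at ha hb
          omega
        · rintro rfl
          exact ⟨0, 0, (h0 _).2 (by omega), (h0 _).2 (by omega), rfl, rfl⟩
      simp only [h2]
    rw [Finset.sum_congr rfl h1, Finset.sum_const, Finset.card_range, bettiLinear]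
    split_ifs <;> simp_all
  induction n using Nat.strong_induction_on with
  | h n ih =>
  rintro (_ | i)
  · exact hzero n
  rcases n with _ | _ | _ | n
  · simp only [Finset.range_zero, Finset.sum_empty, bettiLinear]
    split_ifs <;> omega
  · simp only [Finset.sum_range_succ]
    simp [pathValue, pathSphere, bettiLinear]
    split_ifs <;> omega
  · simp only [Finset.sum_range_succ]
    simp [pathValue, pathSphere, bettiLinear]
    split_ifs <;> omega
  · rw [Finset.sum_range_succ', Finset.sum_range_succ', Finset.sum_range_succ']
    have h3 : ∀ u ∈ Finset.range n,
        (if pathValue (n + 3) (u + 1 + 1 + 1) = some (i + 1) then 1 else 0) =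
          if pathValue n u = some i then 1 else 0 := by
      intro u hu
      rw [Finset.mem_range] at hu
      have e : n + 3 - 1 - (u + 1 + 1 + 1) = n - 1 - u := by omega
      rw [pathValue, e, pathValue, show u + 1 + 1 + 1 = u + 3 from rfl, pathSphere_add_three]
      congr 1
      rw [eq_iff_iff]
      cases pathSphere u <;> cases pathSphere (n - 1 - u) <;> simp
      omega
    rw [Finset.sum_congr rfl h3, ih n (by omega)]
    have e2 : pathValue (n + 3) (0 + 1 + 1) = some (i + 1) ↔ pathSphere n = some i := by
      have : n + 3 - 1 - (0 + 1 + 1) = n := by omega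
      rw [pathValue, this]
      cases pathSphere n <;> simp [pathSphere]
      omega
    have e1 : ¬ pathValue (n + 3) (0 + 1) = some (i + 1) := by simp [pathValue, pathSphere]
    have e0 : pathValue (n + 3) 0 = some (i + 1) ↔ pathSphere (n + 2) = some (i + 1) := by
      rw [pathValue, show n + 3 - 1 - 0 = n + 2 from rfl]
      cases pathSphere (n + 2) <;> simp [pathSphere]
    simp only [e0, e1, e2, pathSphere_eq_some, bettiLinear, if_false, add_zero]
    split_ifs <;> omega

theorem card_pathValue (n i : ℕ) :
    (Finset.univ.filter fun u : Fin n => pathValue n u = some i).card = bettiLinear n i := by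
  rw [Finset.card_filter, ← sum_pathValue,
    Fin.sum_univ_eq_sum_range (fun u => if pathValue n u = some i then 1 else 0)]

/-- Deleting an end vertex or the vertex `2` gives the same value each; the other vertices give
the values of a path with `n - 4` vertices, shifted. -/
theorem card_valueD {n : ℕ} (hn : 4 ≤ n) (i : ℕ) :
    (Finset.univ.filter fun u : Fin n => valueD n u = some i).card = bettiD n i := by
  obtain ⟨m, rfl⟩ := Nat.exists_eq_add_of_le' hn
  rw [Finset.card_filter, Fin.sum_univ_eq_sum_range (fun u => if valueD (m + 4) u = some i then 1
    else 0), Finset.sum_range_succ, Finset.sum_range_succ', Finset.sum_range_succ',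
    Finset.sum_range_succ']
  have h3 : ∀ u ∈ Finset.range m,
      (if valueD (m + 4) (u + 1 + 1 + 1) = some i then 1 else 0) =
        if (pathValue m u).map (· + 1) = some i then 1 else 0 := by
    intro u hu
    rw [Finset.mem_range] at hu
    have e1 : u + 1 + 1 + 1 - 3 = u := by omega
    have e2 : m + 4 - 2 - (u + 1 + 1 + 1) = m - 1 - u := by omega
    have e3 : valueD (m + 4) (u + 1 + 1 + 1) = (pathValue m u).map (· + 1) := by
      rw [valueD, if_neg (by omega), if_neg (by omega), if_neg (by omega), e1, e2, pathValue]
    rw [e3]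
  have e : (pathSphere m).map (· + 1) = pathSphere (m + 3) := (pathSphere_add_three m).symm
  have e2 : valueD (m + 4) (0 + 1 + 1) = pathSphere (m + 3) := by
    rw [valueD, if_neg (by omega), if_neg (by omega), if_pos (by omega), Nat.add_sub_cancel, e]
  have e1 : valueD (m + 4) (0 + 1) = none := by
    rw [valueD, if_neg (by omega), if_pos (by omega)]
  have e0 : valueD (m + 4) 0 = pathSphere (m + 3) := by
    rw [valueD, if_neg (by omega), if_neg (by omega), if_pos (by omega), Nat.add_sub_cancel, e]
  have e4 : valueD (m + 4) (m + 3) = pathSphere (m + 3) := by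
    rw [valueD, if_pos (by omega)]
    rfl
  rw [Finset.sum_congr rfl h3, e0, e1, e2, e4]
  rcases i with _ | i
  · have : ∀ u ∈ Finset.range m,
        (if (pathValue m u).map (· + 1) = some 0 then 1 else 0) = 0 := by
      intro u _
      simp
    rw [Finset.sum_congr rfl this]
    simp only [Finset.sum_const_zero, reduceCtorEq, or_self, if_false, pathSphere_eq_some, bettiD]
    split_ifs <;> omega
  · have : ∀ u ∈ Finset.range m,
        (if (pathValue m u).map (· + 1) = some (i + 1) then 1 else 0) =
          if pathValue m u = some i then 1 else 0 := by
      intro u _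
      simp
    rw [Finset.sum_congr rfl this, sum_pathValue]
    simp only [reduceCtorEq, if_false, pathSphere_eq_some, bettiD, bettiLinear]
    split_ifs <;> omega

theorem card_valueE_six (i : ℕ) :
    (Finset.univ.filter fun u : Fin 6 => valueE 6 u = some i).card = if i = 2 then 1 else 0 := by
  rw [Finset.card_filter]
  simp only [Fin.sum_univ_succ]
  simp [valueE, pathSphere, eq_comm]

theorem card_valueE_seven (i : ℕ) :
    (Finset.univ.filter fun u : Fin 7 => valueE 7 u = some i).card = if i = 2 then 2 else 0 := by
  rw [Finset.card_filter]
  simp only [Fin.sum_univ_succ]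
  by_cases hi : i = 2 <;> simp [valueE, pathSphere, eq_comm, hi]

theorem card_valueE_eight (i : ℕ) :
    (Finset.univ.filter fun u : Fin 8 => valueE 8 u = some i).card = if i = 2 then 1 else 0 := by
  rw [Finset.card_filter]
  simp only [Fin.sum_univ_succ]
  simp [valueE, pathSphere, eq_comm]

end SimpleGraph

/-! ### Graphs without subharmonic functions -/

namespace SimpleGraph

open Classical in
/-- A graph has this property if no nonzero function `v` with values in `ℕ` satisfies
`2 v i ≤ ∑ v j`, the sum over the neighbours `j` of `i`, at all vertices `i`.  The Coxeter graphs
of positive definite Coxeter matrices have it, and the extended Dynkin diagrams do not. -/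
def NoSubharmonic {V : Type*} [Fintype V] (G : SimpleGraph V) : Prop :=
  ∀ v : V → ℕ, (∀ i, 2 * v i ≤ ∑ j with G.Adj i j, v j) → v = 0

/-- It is enough to find sufficiently many neighbours of the vertices of the support. -/
theorem NoSubharmonic.eq_zero {V : Type*} [Fintype V] {G : SimpleGraph V} (hG : G.NoSubharmonic)
    (v : V → ℕ)
    (h : ∀ i, v i ≠ 0 → ∃ s : Finset V, (∀ j ∈ s, G.Adj i j) ∧ 2 * v i ≤ ∑ j ∈ s, v j) :
    v = 0 := by
  refine hG v fun i => ?_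
  by_cases hi : v i = 0
  · simp [hi]
  obtain ⟨s, hs, hle⟩ := h i hi
  refine hle.trans (Finset.sum_le_sum_of_subset fun j hj => ?_)
  simpa using hs j hj

theorem NoSubharmonic.of_injective {V V' : Type*} [Fintype V] [Fintype V'] {G : SimpleGraph V}
    {H : SimpleGraph V'} (hG : G.NoSubharmonic) (f : V' → V) (hf : Function.Injective f)
    (hadj : ∀ a b, H.Adj a b → G.Adj (f a) (f b)) : H.NoSubharmonic := by
  classical
  intro v hv
  have hext : ∀ a, Function.extend f v (0 : V → ℕ) (f a) = v a := fun a =>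
    hf.extend_apply v (0 : V → ℕ) a
  have h0 : Function.extend f v (0 : V → ℕ) = 0 := by
    refine hG.eq_zero _ fun i hi => ?_
    obtain ⟨a, rfl⟩ : ∃ a, f a = i := by
      by_contra h
      exact hi (Function.extend_apply' v (0 : V → ℕ) i h)
    refine ⟨(Finset.univ.filter fun b => H.Adj a b).image f, ?_, ?_⟩
    · intro j hj
      obtain ⟨b, hb, rfl⟩ := Finset.mem_image.1 hj
      exact hadj a b (by simpa using hb)
    · rw [Finset.sum_image hf.injOn]
      simp only [hext]
      convert hv a
  ext a
  rw [← hext a, h0]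
  rfl

theorem NoSubharmonic.of_iso {V V' : Type*} [Fintype V] [Fintype V'] {G : SimpleGraph V}
    {H : SimpleGraph V'} (hG : G.NoSubharmonic) (e : G ≃g H) : H.NoSubharmonic :=
  hG.of_injective e.symm e.symm.injective fun _ _ h => e.symm.map_adj_iff.2 h

/-- The constant function `1` shows that there is a vertex with at most one neighbour. -/
theorem NoSubharmonic.exists_degree_le_one {V : Type*} [Fintype V] [Nonempty V]
    {G : SimpleGraph V} [DecidableRel G.Adj] (hG : G.NoSubharmonic) : ∃ i, G.degree i ≤ 1 := by
  classical
  by_contra! h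
  have := hG (fun _ => (1 : ℕ)) fun i => by
    have := h i
    rw [← G.card_neighborFinset_eq_degree, G.neighborFinset_eq_filter] at this
    rw [Finset.sum_const, smul_eq_mul, mul_one, mul_one]
    refine (Nat.succ_le_of_lt this).trans (le_of_eq ?_)
    congr
  exact one_ne_zero (congrFun this (Classical.arbitrary V))

/-- No injective image of the graph with edge list `E`, when that graph has a nonzero subharmonic
function. -/
theorem NoSubharmonic.false_of_edges {V : Type*} [Fintype V] {G : SimpleGraph V}
    (hG : G.NoSubharmonic) {m : ℕ} (E : List (Fin m × Fin m)) (v : Fin m → ℕ)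
    (hv : ∀ i, 2 * v i ≤ ∑ j with (i, j) ∈ E ∨ (j, i) ∈ E, v j) (h0 : ∃ i, v i ≠ 0)
    (f : Fin m → V) (hf : (List.ofFn f).Nodup) (hE : ∀ e ∈ E, G.Adj (f e.1) (f e.2)) :
    False := by
  have hinj : Function.Injective f := List.nodup_ofFn.1 hf
  have hadj : ∀ a b, ((a, b) ∈ E ∨ (b, a) ∈ E) → G.Adj (f a) (f b) := by
    rintro a b (h | h)
    · exact hE _ h
    · exact (hE _ h).symm
  have hH := hG.of_injective (H := G.comap f) f hinj fun a b h => h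
  obtain ⟨i, hi⟩ := h0
  refine hi (congrFun (hH.eq_zero v fun i _ => ⟨_, fun j hj => ?_, hv i⟩) i)
  exact hadj _ _ (by simpa using hj)

/-- The extended Dynkin diagram of type `E₆`, with its marks. -/
theorem NoSubharmonic.not_extended_E_six {V : Type*} [Fintype V] {G : SimpleGraph V}
    (hG : G.NoSubharmonic) (f : Fin 7 → V) (hf : (List.ofFn f).Nodup)
    (hE : ∀ e ∈ ([(0, 1), (1, 2), (2, 3), (3, 4), (2, 5), (5, 6)] : List (Fin 7 × Fin 7)),
      G.Adj (f e.1) (f e.2)) : False :=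
  hG.false_of_edges _ ![1, 2, 3, 2, 1, 2, 1] (by decide) ⟨0, by decide⟩ f hf hE

/-- The extended Dynkin diagram of type `E₇`, with its marks. -/
theorem NoSubharmonic.not_extended_E_seven {V : Type*} [Fintype V] {G : SimpleGraph V}
    (hG : G.NoSubharmonic) (f : Fin 8 → V) (hf : (List.ofFn f).Nodup)
    (hE : ∀ e ∈ ([(0, 1), (1, 2), (2, 3), (3, 4), (4, 5), (5, 6), (3, 7)] :
      List (Fin 8 × Fin 8)), G.Adj (f e.1) (f e.2)) : False :=
  hG.false_of_edges _ ![1, 2, 3, 4, 3, 2, 1, 2] (by decide) ⟨0, by decide⟩ f hf hE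

/-- The extended Dynkin diagram of type `E₈`, with its marks. -/
theorem NoSubharmonic.not_extended_E_eight {V : Type*} [Fintype V] {G : SimpleGraph V}
    (hG : G.NoSubharmonic) (f : Fin 9 → V) (hf : (List.ofFn f).Nodup)
    (hE : ∀ e ∈ ([(0, 1), (1, 2), (2, 3), (3, 4), (4, 5), (5, 6), (6, 7), (2, 8)] :
      List (Fin 9 × Fin 9)), G.Adj (f e.1) (f e.2)) : False :=
  hG.false_of_edges _ ![2, 4, 6, 5, 4, 3, 2, 1, 3] (by decide) ⟨0, by decide⟩ f hf hE

/-- The extended Dynkin diagrams of type `D`: a path `p 0, …, p l` with two further neighbours at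
either end.  The marks are `2` on the path and `1` at the further vertices. -/
theorem NoSubharmonic.not_extended_D {V : Type*} [Fintype V] {G : SimpleGraph V}
    (hG : G.NoSubharmonic) (p : ℕ → V) (l : ℕ) (hp : ∀ i ≤ l, ∀ j ≤ l, p i = p j → i = j)
    (hadj : ∀ i < l, G.Adj (p i) (p (i + 1))) (a b c d : V) (hnd : [a, b, c, d].Nodup)
    (hne : ∀ i ≤ l, p i ≠ a ∧ p i ≠ b ∧ p i ≠ c ∧ p i ≠ d) (ha : G.Adj (p 0) a)
    (hb : G.Adj (p 0) b) (hc : G.Adj (p l) c) (hd : G.Adj (p l) d) : False := by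
  classical
  let v : V → ℕ := fun x => if ∃ i ≤ l, p i = x then 2 else if x ∈ [a, b, c, d] then 1 else 0
  have hvp : ∀ i ≤ l, v (p i) = 2 := fun i hi => if_pos ⟨i, hi, rfl⟩
  have hve : ∀ x ∈ [a, b, c, d], v x = 1 := by
    intro x hx
    have : ¬ ∃ i ≤ l, p i = x := by
      rintro ⟨i, hi, rfl⟩
      have := hne i hi
      simp only [List.mem_cons, List.not_mem_nil, or_false] at hx
      tauto
    simp only [v]
    rw [if_neg this, if_pos hx]
  simp only [List.nodup_cons, List.mem_cons, List.not_mem_nil, or_false, not_or,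
    List.nodup_nil, and_true, not_false_eq_true] at hnd
  obtain ⟨⟨hab, hac, had⟩, ⟨hbc, hbd⟩, hcd⟩ := hnd
  have hva := hve a (by simp)
  have hvb := hve b (by simp)
  have hvc := hve c (by simp)
  have hvd := hve d (by simp)
  have h0 : v = 0 := by
    refine hG.eq_zero v fun x hx => ?_
    by_cases hxp : ∃ i ≤ l, p i = x
    · obtain ⟨i, hi, rfl⟩ := hxp
      obtain ⟨hia, hib, hic, hid⟩ := hne i hi
      rw [hvp i hi]
      -- the neighbours on the left and on the right contribute `2` each
      rcases i with _ | i
      · rcases l with _ | l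
        · refine ⟨{a, b, c, d}, by simp [ha, hb, hc, hd], ?_⟩
          rw [Finset.sum_insert (by simp [hab, hac, had]), Finset.sum_insert (by simp [hbc, hbd]),
            Finset.sum_pair hcd, hva, hvb, hvc, hvd]
          norm_num
        · obtain ⟨h1, h2, -, -⟩ := hne 1 (by omega)
          refine ⟨{a, b, p 1}, by simp [ha, hb, hadj 0 (by omega)], ?_⟩
          rw [Finset.sum_insert (by simp [hab, h1.symm]), Finset.sum_pair h2.symm, hva, hvb,
            hvp 1 (by omega)]
          norm_num
      · rcases Nat.lt_or_ge (i + 1) l with hil | hil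
        · refine ⟨{p i, p (i + 2)}, ?_, ?_⟩
          · simp [(hadj i (by omega)).symm, hadj (i + 1) hil]
          · rw [Finset.sum_pair, hvp i (by omega), hvp (i + 2) (by omega)]
            intro h
            have := hp _ (by omega) _ (by omega) h
            omega
        · obtain rfl : l = i + 1 := by omega
          obtain ⟨-, -, h3, h4⟩ := hne i (by omega)
          refine ⟨{p i, c, d}, by simp [hc, hd, (hadj i (by omega)).symm], ?_⟩
          rw [Finset.sum_insert (by simp [h3, h4]), Finset.sum_pair hcd, hvc, hvd,
            hvp i (by omega)]
          norm_num
    · have hxe : x ∈ [a, b, c, d] := by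
        by_contra h
        exact hx (by simp only [v]; rw [if_neg hxp, if_neg h])
      rw [hve x hxe]
      simp only [List.mem_cons, List.not_mem_nil, or_false] at hxe
      rcases hxe with rfl | rfl | rfl | rfl
      · exact ⟨{p 0}, by simpa using ha.symm, by simp [hvp 0 (by omega)]⟩
      · exact ⟨{p 0}, by simpa using hb.symm, by simp [hvp 0 (by omega)]⟩
      · exact ⟨{p l}, by simpa using hc.symm, by simp [hvp l le_rfl]⟩
      · exact ⟨{p l}, by simpa using hd.symm, by simp [hvp l le_rfl]⟩
  rw [h0] at hva
  exact zero_ne_one hva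

/-! ### Adding a leaf -/

/-- The graph `H` with one further vertex, the last one, joined to the vertex `j`. -/
def addLeaf {n : ℕ} (H : SimpleGraph (Fin n)) (j : Fin n) : SimpleGraph (Fin (n + 1)) :=
  H.map Fin.castSuccEmb ⊔ edge j.castSucc (Fin.last n)

theorem addLeaf_adj_castSucc {n : ℕ} {H : SimpleGraph (Fin n)} {j a b : Fin n} :
    (addLeaf H j).Adj a.castSucc b.castSucc ↔ H.Adj a b := by
  have h1 : a.castSucc ≠ Fin.last n := (Fin.castSucc_lt_last a).ne
  have h2 : b.castSucc ≠ Fin.last n := (Fin.castSucc_lt_last b).ne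
  rw [addLeaf, sup_adj, Fin.coe_castSuccEmb, map_adj', edge_adj]
  simp only [h1, h2, and_false, or_false, false_and, (Fin.castSucc_injective n).ne_iff,
    (Fin.castSucc_injective n).eq_iff]
  constructor
  · rintro ⟨-, a', b', h, rfl, rfl⟩
    exact h
  · exact fun h => ⟨h.ne, a, b, h, rfl, rfl⟩

theorem addLeaf_adj_last {n : ℕ} {H : SimpleGraph (Fin n)} {j a : Fin n} :
    (addLeaf H j).Adj (Fin.last n) a.castSucc ↔ a = j := by
  have h1 : a.castSucc ≠ Fin.last n := (Fin.castSucc_lt_last a).ne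
  have h2 : ∀ b : Fin n, b.castSucc ≠ Fin.last n := fun b => (Fin.castSucc_lt_last b).ne
  rw [addLeaf, sup_adj, Fin.coe_castSuccEmb, map_adj', edge_adj]
  simp [h2, (h2 _).symm, eq_comm]

/-- A graph is `H` with a leaf if it has a vertex with one neighbour, and `H` is what is left
without that vertex. -/
theorem nonempty_iso_addLeaf {V : Type*} {G : SimpleGraph V} {n : ℕ} {H : SimpleGraph (Fin n)}
    {j : Fin n} (g : Fin n → V) (w : V) (hg : Function.Injective g) (hw : ∀ a, g a ≠ w)
    (hs : ∀ x, x ≠ w → ∃ a, g a = x) (hadj : ∀ a b, G.Adj (g a) (g b) ↔ H.Adj a b)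
    (hleaf : ∀ a, G.Adj w (g a) ↔ a = j) : Nonempty (G ≃g addLeaf H j) := by
  let f : Fin (n + 1) → V := Fin.snoc g w
  have fc : ∀ a : Fin n, f a.castSucc = g a := fun a => Fin.snoc_castSucc ..
  have fl : f (Fin.last n) = w := Fin.snoc_last ..
  have hinj : Function.Injective f := by
    intro a b
    induction a using Fin.lastCases with
    | last =>
      induction b using Fin.lastCases with
      | last => exact fun _ => rfl
      | cast b =>
        rw [fc, fl]
        exact fun h => absurd h.symm (hw b)
    | cast a =>
      induction b using Fin.lastCases with
      | last =>
        rw [fc, fl]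
        exact fun h => absurd h (hw a)
      | cast b =>
        rw [fc, fc]
        exact fun h => congrArg _ (hg h)
  have hsurj : Function.Surjective f := by
    intro x
    by_cases hx : x = w
    · exact ⟨Fin.last n, by rw [fl, hx]⟩
    · obtain ⟨a, rfl⟩ := hs x hx
      exact ⟨a.castSucc, fc a⟩
  refine ⟨Iso.symm ⟨Equiv.ofBijective f ⟨hinj, hsurj⟩, ?_⟩⟩
  intro a b
  change G.Adj (f a) (f b) ↔ (addLeaf H j).Adj a b
  induction a using Fin.lastCases with
  | last =>
    induction b using Fin.lastCases with
    | last => simp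
    | cast b => rw [fc, fl, hleaf, addLeaf_adj_last]
  | cast a =>
    induction b using Fin.lastCases with
    | last => rw [fc, fl, G.adj_comm, (addLeaf H j).adj_comm, hleaf, addLeaf_adj_last]
    | cast b => rw [fc, fc, hadj, addLeaf_adj_castSucc]

/-- A path with a leaf is a branched path, by definition. -/
theorem nonempty_branchedPath_iso_addLeaf_path {n : ℕ} (j : Fin n) :
    Nonempty (branchedPath j (n + 1) ≃g addLeaf (pathGraph n) j) := by
  refine nonempty_iso_addLeaf Fin.castSucc (Fin.last n) (Fin.castSucc_injective n)
    (fun a => (Fin.castSucc_lt_last a).ne) (fun x hx => ⟨x.castPred hx, by simp⟩) ?_ ?_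
  · intro a b
    rw [branchedPath_adj_of_lt (by simp) (by simp), pathGraph_adj_iff]
    simp
  · intro a
    rw [branchedPath_adj]
    simp only [Ne, Fin.ext_iff, Fin.val_last, Fin.val_castSucc]
    grind

/-- A leaf at the far end of the path. -/
theorem nonempty_branchedPath_iso_addLeaf_end {k n : ℕ} (hk : k + 1 < n) (j : Fin n)
    (hj : (j : ℕ) + 2 = n) :
    Nonempty (branchedPath k (n + 1) ≃g addLeaf (branchedPath k n) j) := by
  refine nonempty_iso_addLeaf
    (fun a => ⟨if (a : ℕ) + 1 = n then n else a, by split_ifs <;> omega⟩)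
    ⟨n - 1, by omega⟩ ?_ ?_ ?_ ?_ ?_
  · intro a b h
    simp only [Fin.ext_iff] at h ⊢
    split_ifs at h <;> omega
  · intro a
    simp only [Ne, Fin.ext_iff]
    split_ifs <;> omega
  · intro x hx
    simp only [Ne, Fin.ext_iff] at hx
    by_cases h : (x : ℕ) = n
    · refine ⟨⟨n - 1, by omega⟩, Fin.ext ?_⟩
      simp only
      split_ifs <;> omega
    · refine ⟨⟨x, by omega⟩, Fin.ext ?_⟩
      simp only
      split_ifs <;> omega
  · intro a b
    rw [branchedPath_adj, branchedPath_adj]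
    simp only [Ne, Fin.ext_iff]
    split_ifs <;> omega
  · intro a
    rw [branchedPath_adj]
    simp only [Ne, Fin.ext_iff]
    split_ifs <;> omega

/-- A leaf at the beginning of the path. -/
theorem nonempty_branchedPath_iso_addLeaf_zero {k n : ℕ} (hk : k + 1 < n) (j : Fin n)
    (hj : (j : ℕ) = 0) :
    Nonempty (branchedPath (k + 1) (n + 1) ≃g addLeaf (branchedPath k n) j) := by
  refine nonempty_iso_addLeaf (fun a => ⟨a + 1, by omega⟩) ⟨0, by omega⟩ ?_ ?_ ?_ ?_ ?_
  · intro a b h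
    simp only [Fin.ext_iff] at h ⊢
    omega
  · intro a
    simp only [Ne, Fin.ext_iff]
    omega
  · intro x hx
    simp only [Ne, Fin.ext_iff] at hx
    exact ⟨⟨x - 1, by omega⟩, Fin.ext (by simp only; omega)⟩
  · intro a b
    rw [branchedPath_adj, branchedPath_adj]
    simp only [Ne, Fin.ext_iff]
    omega
  · intro a
    rw [branchedPath_adj]
    simp only [Ne, Fin.ext_iff]
    omega

/-- A leaf at the additional vertex, when that is joined to the second vertex of the path. -/
theorem nonempty_branchedPath_iso_addLeaf_branch {n : ℕ} (hn : 3 ≤ n) (j : Fin n)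
    (hj : (j : ℕ) + 1 = n) :
    Nonempty (branchedPath 2 (n + 1) ≃g addLeaf (branchedPath 1 n) j) := by
  refine nonempty_iso_addLeaf
    (fun a => ⟨if (a : ℕ) = 0 then n else if (a : ℕ) + 1 = n then 1 else a + 1, by
      split_ifs <;> omega⟩) ⟨0, by omega⟩ ?_ ?_ ?_ ?_ ?_
  · intro a b h
    simp only [Fin.ext_iff] at h ⊢
    split_ifs at h <;> omega
  · intro a
    simp only [Ne, Fin.ext_iff]
    split_ifs <;> grind
  · intro x hx
    simp only [Ne, Fin.ext_iff] at hx
    refine ⟨⟨if (x : ℕ) = n then 0 else if (x : ℕ) = 1 then n - 1 else x - 1, by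
      split_ifs <;> omega⟩, Fin.ext ?_⟩
    simp only
    split_ifs <;> omega
  · intro a b
    rw [branchedPath_adj, branchedPath_adj]
    simp only [Ne, Fin.ext_iff]
    split_ifs <;> omega
  · intro a
    rw [branchedPath_adj]
    simp only [Ne, Fin.ext_iff]
    split_ifs <;> grind

/-- Reversing the path. -/
theorem nonempty_branchedPath_iso_reverse {k k' n : ℕ} (h : k + k' + 2 = n) :
    Nonempty (branchedPath k n ≃g branchedPath k' n) := by
  let r : Fin n → Fin n := fun a => ⟨if (a : ℕ) + 1 = n then n - 1 else n - 2 - a, by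
    split_ifs <;> omega⟩
  have hr : Function.Involutive r := by
    intro a
    simp only [r, Fin.ext_iff]
    split_ifs <;> omega
  refine ⟨⟨hr.toPerm, ?_⟩⟩
  intro a b
  rw [Function.Involutive.coe_toPerm, branchedPath_adj, branchedPath_adj]
  simp only [r, Ne, Fin.ext_iff]
  split_ifs <;> omega

theorem nonempty_branchedPath_zero_iso {n : ℕ} (hn : 2 ≤ n) :
    Nonempty (branchedPath 0 n ≃g pathGraph n) := by
  refine ⟨⟨⟨fun a => ⟨if (a : ℕ) + 1 = n then 0 else a + 1, by split_ifs <;> omega⟩,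
    fun a => ⟨if (a : ℕ) = 0 then n - 1 else a - 1, by split_ifs <;> omega⟩, ?_, ?_⟩, ?_⟩⟩
  · intro a
    simp only [Fin.ext_iff]
    split_ifs <;> grind
  · intro a
    simp only [Fin.ext_iff]
    split_ifs <;> omega
  · intro a b
    rw [Equiv.coe_fn_mk, branchedPath_adj, pathGraph_adj_iff]
    simp only [Ne, Fin.ext_iff]
    split_ifs <;> grind

end SimpleGraph

/-! ### Classification -/

namespace SimpleGraph

/-- A graph that is a path with `n` vertices, or of type `D n` with `4 ≤ n`, or of type `E 6`,
`E 7` or `E 8`. -/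
def IsPathOrDE {V : Type*} (G : SimpleGraph V) (n : ℕ) : Prop :=
  Nonempty (G ≃g pathGraph n) ∨ (4 ≤ n ∧ Nonempty (G ≃g graphD n)) ∨
    Nonempty (G ≃g graphE 6) ∨ Nonempty (G ≃g graphE 7) ∨ Nonempty (G ≃g graphE 8)

theorem IsPathOrDE.of_iso {V V' : Type*} {G : SimpleGraph V} {H : SimpleGraph V'} {n : ℕ}
    (e : G ≃g H) (h : H.IsPathOrDE n) : G.IsPathOrDE n :=
  h.imp (.map e.trans) <| .imp (.imp_right (.map e.trans)) <| .imp (.map e.trans) <|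
    .imp (.map e.trans) (.map e.trans)

theorem NoSubharmonic.isPathOrDE_branchedPath {k n : ℕ} (hk : k + 2 ≤ n)
    (h : (branchedPath k n).NoSubharmonic) : (branchedPath k n).IsPathOrDE n := by
  wlog hle : 2 * k + 2 ≤ n generalizing k
  · obtain ⟨e⟩ := nonempty_branchedPath_iso_reverse (show k + (n - 2 - k) + 2 = n by omega)
    exact (this (k := n - 2 - k) (by omega) (h.of_iso e) (by omega)).of_iso e
  obtain rfl | rfl | rfl | hk3 : k = 0 ∨ k = 1 ∨ k = 2 ∨ 3 ≤ k := by omega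
  · exact Or.inl (nonempty_branchedPath_zero_iso hk)
  · exact Or.inr (Or.inl ⟨hle, ⟨Iso.refl⟩⟩)
  · by_cases hn : 9 ≤ n
    · refine (h.not_extended_E_eight ![⟨0, by omega⟩, ⟨1, by omega⟩, ⟨2, by omega⟩, ⟨3, by omega⟩,
        ⟨4, by omega⟩, ⟨5, by omega⟩, ⟨6, by omega⟩, ⟨7, by omega⟩, ⟨n - 1, by omega⟩] ?_ ?_).elim
      · simp [Fin.ext_iff]
        omega
      · simp [branchedPath_adj]
        omega
    · obtain rfl | rfl | rfl : n = 6 ∨ n = 7 ∨ n = 8 := by omega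
      · exact Or.inr (Or.inr (Or.inl ⟨Iso.refl⟩))
      · exact Or.inr (Or.inr (Or.inr (Or.inl ⟨Iso.refl⟩)))
      · exact Or.inr (Or.inr (Or.inr (Or.inr ⟨Iso.refl⟩)))
  · refine (h.not_extended_E_seven ![⟨k - 3, by omega⟩, ⟨k - 2, by omega⟩, ⟨k - 1, by omega⟩,
      ⟨k, by omega⟩, ⟨k + 1, by omega⟩, ⟨k + 2, by omega⟩, ⟨k + 3, by omega⟩, ⟨n - 1, by omega⟩]
      ?_ ?_).elim
    · simp [Fin.ext_iff]
      omega
    · simp [branchedPath_adj]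
      omega

theorem NoSubharmonic.isPathOrDE_addLeaf_path {n : ℕ} {j : Fin n}
    (h : (addLeaf (pathGraph n) j).NoSubharmonic) :
    (addLeaf (pathGraph n) j).IsPathOrDE (n + 1) := by
  obtain ⟨e⟩ := nonempty_branchedPath_iso_addLeaf_path j
  exact ((h.of_iso e.symm).isPathOrDE_branchedPath (by omega)).of_iso e.symm

theorem addLeaf_branchedPath_adj {k n : ℕ} (hk : k + 1 < n) {j : Fin n} {a b : Fin (n + 1)} :
    (addLeaf (branchedPath k n) j).Adj a b ↔
      (((a : ℕ) + 1 = b ∧ (b : ℕ) + 1 < n) ∨ ((a : ℕ) = k ∧ (b : ℕ) + 1 = n) ∨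
        ((a : ℕ) = j ∧ (b : ℕ) = n)) ∨
      (((b : ℕ) + 1 = a ∧ (a : ℕ) + 1 < n) ∨ ((b : ℕ) = k ∧ (a : ℕ) + 1 = n) ∨
        ((b : ℕ) = j ∧ (a : ℕ) = n)) := by
  induction a using Fin.lastCases with
  | last =>
    induction b using Fin.lastCases with
    | last =>
      refine iff_of_false (SimpleGraph.irrefl _) ?_
      rw [Fin.val_last]
      omega
    | cast b =>
      rw [addLeaf_adj_last, Fin.ext_iff]
      simp only [Fin.val_last, Fin.val_castSucc, and_true]
      omega
  | cast a =>
    induction b using Fin.lastCases with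
    | last =>
      rw [adj_comm, addLeaf_adj_last, Fin.ext_iff]
      simp only [Fin.val_last, Fin.val_castSucc, and_true]
      omega
    | cast b =>
      rw [addLeaf_adj_castSucc, branchedPath_adj, Ne, Fin.ext_iff]
      simp only [Fin.val_castSucc]
      omega

/-- A leaf at a vertex of a graph of type `D` or `E` other than the ends of the arms produces a
second branching or a vertex with four neighbours, so it contains an extended Dynkin diagram of
type `D`; at the end of an arm it lengthens the arm. -/
theorem NoSubharmonic.isPathOrDE_addLeaf_branchedPath {k n : ℕ}
    (hkn : k = 1 ∧ 4 ≤ n ∨ k = 2 ∧ 6 ≤ n) {j : Fin n}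
    (h : (addLeaf (branchedPath k n) j).NoSubharmonic) :
    (addLeaf (branchedPath k n) j).IsPathOrDE (n + 1) := by
  have hk : k + 1 < n := by omega
  obtain hj | hj | hj | hj | hj : (j : ℕ) + 2 = n ∨ (j : ℕ) = 0 ∨ (j : ℕ) + 1 = n ∨
      (k ≤ (j : ℕ) ∧ (j : ℕ) + 2 < n) ∨ (k = 2 ∧ (j : ℕ) = 1) := by omega
  · obtain ⟨e⟩ := nonempty_branchedPath_iso_addLeaf_end hk j hj
    exact ((h.of_iso e.symm).isPathOrDE_branchedPath (by omega)).of_iso e.symm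
  · obtain ⟨e⟩ := nonempty_branchedPath_iso_addLeaf_zero hk j hj
    exact ((h.of_iso e.symm).isPathOrDE_branchedPath (by omega)).of_iso e.symm
  · rcases hkn with ⟨rfl, hn⟩ | ⟨rfl, hn⟩
    · obtain ⟨e⟩ := nonempty_branchedPath_iso_addLeaf_branch (by omega) j hj
      exact ((h.of_iso e.symm).isPathOrDE_branchedPath (by omega)).of_iso e.symm
    · refine (h.not_extended_E_six ![⟨0, by omega⟩, ⟨1, by omega⟩, ⟨2, by omega⟩, ⟨3, by omega⟩,
        ⟨4, by omega⟩, ⟨n - 1, by omega⟩, ⟨n, by omega⟩] ?_ ?_).elim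
      · simp [Fin.ext_iff]
        omega
      · simp [addLeaf_branchedPath_adj hk]
        omega
  · refine (h.not_extended_D (fun i => ⟨min (k + i) n, by omega⟩) (j - k) ?_ ?_ ⟨k - 1, by omega⟩
      ⟨n - 1, by omega⟩ ⟨j + 1, by omega⟩ ⟨n, by omega⟩ ?_ ?_ ?_ ?_ ?_ ?_).elim
    · intro a ha b hb hab
      simp only [Fin.ext_iff] at hab
      omega
    · intro i hi
      rw [addLeaf_branchedPath_adj hk]
      simp only
      omega
    · simp [Fin.ext_iff]
      omega
    · intro i hi
      simp only [Ne, Fin.ext_iff]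
      omega
    all_goals
      rw [addLeaf_branchedPath_adj hk]
      grind
  · refine (h.not_extended_D (fun i => ⟨min (i + 1) n, by omega⟩) 1 ?_ ?_ ⟨0, by omega⟩
      ⟨n, by omega⟩ ⟨3, by omega⟩ ⟨n - 1, by omega⟩ ?_ ?_ ?_ ?_ ?_ ?_).elim
    · intro a ha b hb hab
      simp only [Fin.ext_iff] at hab
      omega
    · intro i hi
      rw [addLeaf_branchedPath_adj hk]
      simp only
      omega
    · simp [Fin.ext_iff]
      omega
    · intro i hi
      simp only [Ne, Fin.ext_iff]
      omega
    all_goals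
      rw [addLeaf_branchedPath_adj hk]
      grind

/-- By induction on the number of vertices: remove a leaf. -/
theorem NoSubharmonic.isPathOrDE {n : ℕ} : ∀ {V : Type*} [Fintype V] {G : SimpleGraph V},
    G.NoSubharmonic → G.Connected → Fintype.card V = n → G.IsPathOrDE n := by
  classical
  induction n with
  | zero =>
    intro V _ G _ hc hcard
    have := hc.nonempty
    exact absurd hcard Fintype.card_ne_zero
  | succ n ih =>
    intro V _ G hG hc hcard
    have hne := hc.nonempty
    rcases n with _ | n
    · obtain ⟨e⟩ := Fintype.card_eq.1 (hcard.trans (Fintype.card_fin 1).symm)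
      have := Fintype.card_le_one_iff_subsingleton.1 hcard.le
      refine Or.inl ⟨⟨e, fun {a b} => ?_⟩⟩
      rw [Subsingleton.elim a b]
      simp
    have : Nontrivial V := Fintype.one_lt_card_iff_nontrivial.1 (by omega)
    obtain ⟨w, hw⟩ := hG.exists_degree_le_one
    have hdeg : G.degree w = 1 :=
      le_antisymm hw (hc.preconnected.degree_pos_of_nontrivial w)
    obtain ⟨x, hx, hxu⟩ := degree_eq_one_iff_existsUnique_adj.1 hdeg
    have hG' : (G.induce {w}ᶜ).NoSubharmonic :=
      hG.of_injective Subtype.val Subtype.val_injective fun _ _ h => h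
    have hcard' : Fintype.card ({w}ᶜ : Set V) = n + 1 := by
      rw [Fintype.card_compl_set, hcard]
      simp
    have hxw : x ∈ ({w}ᶜ : Set V) := hx.ne'
    -- the shape of what is left when the leaf is removed determines the shape of the graph
    have key : ∀ {m : ℕ} {H : SimpleGraph (Fin m)} (e : G.induce {w}ᶜ ≃g H),
        Nonempty (G ≃g addLeaf H (e ⟨x, hxw⟩)) := by
      intro m H e
      refine nonempty_iso_addLeaf (fun a => (e.symm a : V)) w ?_ (fun a => (e.symm a).2) ?_ ?_ ?_
      · exact fun a b hab => e.symm.injective (Subtype.ext hab)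
      · intro y hy
        exact ⟨e ⟨y, hy⟩, by simp⟩
      · intro a b
        exact e.symm.map_adj_iff
      · intro a
        constructor
        · intro ha
          have : e.symm a = ⟨x, hxw⟩ := Subtype.ext (hxu _ ha)
          rw [← this, e.apply_symm_apply]
        · rintro rfl
          simpa using hx
    have hm : ∀ {m : ℕ} {H : SimpleGraph (Fin m)}, (G.induce {w}ᶜ ≃g H) → m = n + 1 :=
      fun e => by rw [← hcard', Fintype.card_congr e.toEquiv, Fintype.card_fin]
    rcases ih hG' (hc.induce_compl_singleton_of_degree_eq_one hdeg) hcard' with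
      ⟨⟨e⟩⟩ | ⟨hn, ⟨e⟩⟩ | ⟨⟨e⟩⟩ | ⟨⟨e⟩⟩ | ⟨⟨e⟩⟩
    · obtain ⟨e'⟩ := key e
      exact ((hG.of_iso e').isPathOrDE_addLeaf_path).of_iso e'
    · obtain ⟨e'⟩ := key e
      exact ((hG.of_iso e').isPathOrDE_addLeaf_branchedPath (Or.inl ⟨rfl, hn⟩)).of_iso e'
    all_goals
      obtain ⟨e'⟩ := key e
      rw [← hm e]
      exact ((hG.of_iso e').isPathOrDE_addLeaf_branchedPath
        (Or.inr ⟨rfl, by norm_num⟩)).of_iso e'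

end SimpleGraph

/-! ### Finite Coxeter groups -/

theorem CoxeterMatrix.two_mul_gram_le {B : Type*} (M : CoxeterMatrix B) {i j : B}
    (h : M.coxeterGraph.Adj i j) : 2 * M.gram i j ≤ -1 := by
  obtain ⟨hij, h2⟩ := h
  have h1 : M i j ≠ 1 := M.off_diagonal i j hij
  rw [CoxeterMatrix.gram]
  suffices 1 / 2 ≤ Real.cos (Real.pi / M i j) by linarith
  rcases Nat.eq_zero_or_pos (M i j) with h0 | h0
  · rw [h0]
    norm_num
  · have h3 : (3 : ℝ) ≤ M i j := by exact_mod_cast (by omega : 3 ≤ M i j)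
    rw [← Real.cos_pi_div_three]
    have hpi := Real.pi_pos
    refine Real.cos_le_cos_of_nonneg_of_le_pi (by positivity) (by linarith) ?_
    gcongr

open Classical in
/-- The value of a simple coroot at a nonnegative combination of simple roots is at most what the
Coxeter graph with all labels `3` gives. -/
theorem CoxeterMatrix.simpleCoroot_le {B : Type*} [Fintype B] (M : CoxeterMatrix B) (i : B)
    {v : B → ℝ} (hv : ∀ j, 0 ≤ v j) :
    M.simpleCoroot i v ≤ 2 * v i - ∑ j with M.coxeterGraph.Adj i j, v j := by
  rw [M.simpleCoroot_apply, ← Finset.add_sum_erase _ _ (Finset.mem_univ i), sub_eq_add_neg]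
  refine add_le_add (by simp [CoxeterMatrix.gram]) ?_
  rw [← Finset.sum_neg_distrib, Finset.sum_filter]
  have hi : (if M.coxeterGraph.Adj i i then -v i else 0) = 0 := by simp
  rw [← Finset.add_sum_erase _ _ (Finset.mem_univ i), hi, zero_add]
  refine Finset.sum_le_sum fun j hj => ?_
  have hij : i ≠ j := (Finset.ne_of_mem_erase hj).symm
  split_ifs with h
  · nlinarith [hv j, M.two_mul_gram_le h]
  · have h2 : M i j = 2 := by
      by_contra h2
      exact h ⟨hij, h2⟩
    simp [CoxeterMatrix.gram, h2]

/-- Averaging the standard inner product gives an invariant one, `⟪v, w⟫`.  It satisfies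
`2 ⟪α i, v⟫ = ⟪α i, α i⟫ * simpleCoroot i v`, so for a subharmonic function `v` on the Coxeter graph
`⟪v, v⟫ = ∑ v i ⟪α i, v⟫` is not positive. -/
theorem CoxeterSystem.noSubharmonic {B : Type*} [Fintype B] [DecidableEq B] {M : CoxeterMatrix B}
    {W : Type*} [Group W] [Finite W] (cs : CoxeterSystem M W) :
    M.coxeterGraph.NoSubharmonic := by
  classical
  have := Fintype.ofFinite W
  intro v hv
  let q : (B → ℝ) → (B → ℝ) → ℝ := fun x y =>
    ∑ g : W, ∑ b, cs.reflectionRep g x b * cs.reflectionRep g y b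
  have hinv : ∀ h x y, q (cs.reflectionRep h x) (cs.reflectionRep h y) = q x y := by
    intro h x y
    simp only [q]
    refine Fintype.sum_equiv (Equiv.mulRight h) _ _ fun g => ?_
    simp only [Equiv.coe_mulRight, map_mul, Module.End.mul_apply]
  have hsymm : ∀ x y, q x y = q y x := fun x y => by
    simp only [q, mul_comm]
  have hadd : ∀ x y z, q x (y + z) = q x y + q x z := fun x y z => by
    simp only [q, map_add, Pi.add_apply, mul_add, Finset.sum_add_distrib]
  have hsmul : ∀ (c : ℝ) x y, q x (c • y) = c * q x y := fun c x y => by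
    simp only [q, map_smul, Pi.smul_apply, smul_eq_mul, Finset.mul_sum]
    exact Finset.sum_congr rfl fun _ _ => Finset.sum_congr rfl fun _ _ => by ring
  have hpos : ∀ x, x ≠ 0 → 0 < q x x := by
    intro x hx
    have hnn : ∀ g ∈ (Finset.univ : Finset W),
        0 ≤ ∑ b, cs.reflectionRep g x b * cs.reflectionRep g x b :=
      fun g _ => Finset.sum_nonneg fun b _ => mul_self_nonneg _
    refine lt_of_lt_of_le ?_ (Finset.single_le_sum hnn (Finset.mem_univ 1))
    obtain ⟨b, hb⟩ := Function.ne_iff.1 hx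
    refine Finset.sum_pos' (fun b _ => mul_self_nonneg _) ⟨b, Finset.mem_univ b, ?_⟩
    rw [map_one]
    exact mul_self_pos.2 hb
  let α : B → B → ℝ := fun i => Pi.single i 1
  have hroot : ∀ i x, 2 * q (α i) x = q (α i) (α i) * M.simpleCoroot i x := by
    intro i x
    have h1 := hinv (cs.simple i) (α i) x
    have h2 : cs.reflectionRep (cs.simple i) (α i) = (-1 : ℝ) • α i := by
      rw [cs.reflectionRep_simple, M.simpleCoroot_self]
      module
    have h3 : cs.reflectionRep (cs.simple i) x = x + (-M.simpleCoroot i x) • α i := by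
      rw [cs.reflectionRep_simple]
      module
    rw [h2, h3, hsymm, hsmul, hsymm, hadd, hsmul] at h1
    linarith
  by_contra hne
  have hx : (fun i => (v i : ℝ)) ≠ 0 := fun h => hne (by
    ext i
    have := congrFun h i
    simpa using this)
  set x : B → ℝ := fun i => (v i : ℝ) with hxdef
  have hexp : q x x = ∑ i, x i * q (α i) x := by
    have hlin : ∀ y, q x y = ∑ i, y i * q x (α i) := by
      intro y
      let L : (B → ℝ) →ₗ[ℝ] ℝ :=
        { toFun := q x
          map_add' := hadd x
          map_smul' := fun c y => hsmul c x y }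
      have := LinearMap.pi_apply_eq_sum_univ L y
      refine this.trans (Finset.sum_congr rfl fun i _ => ?_)
      rw [smul_eq_mul]
      have hα : (fun j => if i = j then (1 : ℝ) else 0) = α i := by
        ext j
        simp [α, Pi.single_apply, eq_comm]
      rw [hα]
      rfl
    rw [hlin x]
    exact Finset.sum_congr rfl fun i _ => by rw [hsymm]
  have hle : q x x ≤ 0 := by
    rw [hexp]
    refine Finset.sum_nonpos fun i _ => mul_nonpos_of_nonneg_of_nonpos (Nat.cast_nonneg _) ?_
    have hc : 0 < q (α i) (α i) := hpos _ (by simp [α])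
    have h1 := M.simpleCoroot_le i (v := x) fun j => Nat.cast_nonneg _
    have h2 : 2 * x i ≤ ∑ j with M.coxeterGraph.Adj i j, x j := by
      simp only [hxdef]
      rw [← Nat.cast_sum]
      exact_mod_cast hv i
    nlinarith [hroot i x]
  exact absurd (hpos x hx) (not_lt.2 hle)

theorem mainTheorem1 {B : Type*} [Fintype B] [LinearOrder B] (M : CoxeterMatrix B)
    {W : Type*} [Group W] [Finite W] (cs : CoxeterSystem M W)
    (hirr : M.coxeterGraph.Connected) (n : ℕ) (hn : Fintype.card B = n) :
    -- the Coxeter graph is a path or of type `D`, `E`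
    (Nonempty (M.coxeterGraph ≃g SimpleGraph.pathGraph n) ∨
      (4 ≤ n ∧ Nonempty (M.coxeterGraph ≃g graphD n)) ∨
      Nonempty (M.coxeterGraph ≃g graphE 6) ∨
      Nonempty (M.coxeterGraph ≃g graphE 7) ∨
      Nonempty (M.coxeterGraph ≃g graphE 8)) ∧
    -- linear graphs
    (Nonempty (M.coxeterGraph ≃g SimpleGraph.pathGraph n) → ∀ i : ℕ,
      Nonempty (cs.coxeterCohomology cs.reflectionRep i ≃ₗ[ℝ] (Fin (bettiLinear n i) → ℝ))) ∧
    -- type `D`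
    (4 ≤ n → Nonempty (M.coxeterGraph ≃g graphD n) → ∀ i : ℕ,
      Nonempty (cs.coxeterCohomology cs.reflectionRep i ≃ₗ[ℝ] (Fin (bettiD n i) → ℝ))) ∧
    -- types `E 6`, `E 7`, `E 8`
    (Nonempty (M.coxeterGraph ≃g graphE 6) → ∀ i : ℕ,
      Nonempty (cs.coxeterCohomology cs.reflectionRep i ≃ₗ[ℝ]
        (Fin (if i = 2 then 1 else 0) → ℝ))) ∧
    (Nonempty (M.coxeterGraph ≃g graphE 7) → ∀ i : ℕ,
      Nonempty (cs.coxeterCohomology cs.reflectionRep i ≃ₗ[ℝ]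
        (Fin (if i = 2 then 2 else 0) → ℝ))) ∧
    (Nonempty (M.coxeterGraph ≃g graphE 8) → ∀ i : ℕ,
      Nonempty (cs.coxeterCohomology cs.reflectionRep i ≃ₗ[ℝ]
        (Fin (if i = 2 then 1 else 0) → ℝ))) := by
  refine ⟨cs.noSubharmonic.isPathOrDE hirr hn, ?_, ?_, ?_, ?_, ?_⟩
  · rintro ⟨e⟩ i
    rw [← SimpleGraph.card_pathValue]
    exact cs.nonempty_coxeterCohomology_equiv_fin e _ SimpleGraph.indepSphere_pathGraph i
  · rintro h4 ⟨e⟩ i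
    rw [← SimpleGraph.card_valueD h4]
    exact cs.nonempty_coxeterCohomology_equiv_fin e _ (SimpleGraph.indepSphere_graphD h4) i
  · rintro ⟨e⟩ i
    rw [← SimpleGraph.card_valueE_six]
    exact cs.nonempty_coxeterCohomology_equiv_fin e _
      (SimpleGraph.indepSphere_graphE (by norm_num)) i
  · rintro ⟨e⟩ i
    rw [← SimpleGraph.card_valueE_seven]
    exact cs.nonempty_coxeterCohomology_equiv_fin e _
      (SimpleGraph.indepSphere_graphE (by norm_num)) i
  · rintro ⟨e⟩ i
    rw [← SimpleGraph.card_valueE_eight]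
    exact cs.nonempty_coxeterCohomology_equiv_fin e _
      (SimpleGraph.indepSphere_graphE (by norm_num)) i
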